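/- Let $q$ be multiplication by $x$ and $p=-i\,d/dx$, $p^2=-d^2/dx^2$ on $L^2(\mathbb R)$, with their natural domains ($D(p)=H^1(\mathbb R)$, $D(p^2)=H^2(\mathbb R)$). On $\mathbb C^2\otimes L^2(\mathbb R)\simeq L^2(\mathbb R)\oplus L^2(\mathbb R)$ let $H=q\oplus p^2$, and let $X,Z$ be the Pauli matrices, acting on $\mathbb C^2$. For an integer $n\ge1$ and $t\in\mathbb R$ let $$U_n(t)=\Big(X e^{-i\frac{t}{2n}H}X\; e^{-i\frac{t}{2n}H}\Big)^n$$ be the evolution after $n$ decoupling cycles $(\mathbf 1,X)$ in total time $t$. For $\gamma>0$ let $\xi_\gamma\in L^2(\mathbb R)$ be the environment state with momentum-space wave function $\hat\xi_\gamma(k)=\big(\frac{\gamma}{2\pi}\frac{1}{k^2+\gamma^2/4}\big)^{1/2}$; for a qubit density matrix $\rho$ let $\rho_s(t)=\operatorname{tr}_e\big[U_n(t)(\rho\otimes|\xi_\gamma\rangle\langle\xi_\gamma|)U_n(t)^*\big]$, so that $\rho_s(0)=\rho$. Let $|+\rangle=(\frac1{\sqrt2},\frac1{\sqrt2})$. Then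 the following hold. 1. $q$, $p$, $p^2$, $H$ are self-adjoint. The operator $q+p^2$ is essentially self-adjoint on the Schwartz space; write $q+p^2$ also for its closure. On $D(H)\cap X D(H)$ one has $H+XHX=\mathbf 1\otimes(q+p^2)$ (with $q+p^2$ on $D(q)\cap D(p^2)$), and this is essentially self-adjoint. The unitary groups used here are the strongly continuous groups generated by the respective operators. 2. Dynamical decoupling with $V=\{\mathbf 1,X\}$ works uniformly: for $B=\frac12(q+p^2)$ and every cycle $(v_1,\dots,v_N)$, $N\geq 1$, through $V$ that reaches both elements of $V$ equally often, $$\Big(e^{i\frac{t}{nN}v_1Hv_1^*}\cdots e^{i\frac{t}{nN}v_NHv_N^*}\Big)^n\to e^{it(\mathbf 1\otimes B)}$$ strongly as $n\to\infty$, uniformly for $t$ in compact intervals. 3. For all $n\ge 1$ and $t\in\mathbb R$, $$U_n(t)=e^{-i\frac t2\left(\mathbf 1\otimes(q+p^2)+\frac{t^2}{24n^2}\right)}\;e^{-i\frac{t^3}{16n}(Z\otimes\mathbf 1)}\;e^{i\frac{t^2}{4n}(Z\otimes p)} .$$ 4. $\|\xi_\gamma\|=1$ for all $\gamma>0$. For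 $\rho_s(0)=|+\rangle\langle+|$ and all $\gamma>0$, $n\ge1$, $t\in\mathbb R$, the decoupling error is $$2\big(1-\langle+|\rho_s(t)|+\rangle\big)=1-\cos\!\Big(\frac{t^3}{8n}\Big)e^{-\frac{t^2\gamma}{4n}},$$ and the squared Hilbert–Schmidt distance is $$\|\rho_s(t)-\rho_s(0)\|_2^2=\tfrac12\Big(1-2\cos\!\Big(\frac{t^3}{8n}\Big)e^{-\frac{t^2\gamma}{4n}}+e^{-\frac{t^2\gamma}{2n}}\Big),$$ which is the maximum of $\|\rho_s(t)-\rho_s(0)\|_2^2$ over all initial qubit density matrices. 5. For $\rho_s(0)=|+\rangle\langle+|$ and fixed $\gamma>0$ and $t\in\mathbb R$, both errors in 4 tend to $0$ as $n\to\infty$. For fixed $n\ge1$ and $t\ne0$, decoupling becomes arbitrarily bad by the choice of $\gamma$: as $\gamma\to\infty$, $\rho_s(t)$ tends to the maximally mixed state $\frac12\mathbf 1$, and the two errors tend to $1$ and $\frac12$, respectively. -/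

import Mathlib

open MeasureTheory Filter Topology ComplexConjugate
open scoped ComplexOrder SchwartzMap FourierTransform ENNReal Matrix

noncomputable section

namespace Decoupling

/-- The environment space `L²(ℝ)`. -/
abbrev Env : Type := Lp ℂ 2 (volume : Measure ℝ)

/-- The total space `ℂ² ⊗ L²(ℝ) ≃ L²(ℝ) ⊕ L²(ℝ)` of a qubit coupled to the environment. -/
abbrev Total : Type := PiLp 2 (fun _ : Fin 2 => Env)

/-- Operators on the qubit space `ℂ²`. -/
abbrev QMat : Type := Matrix (Fin 2) (Fin 2) ℂ

/-! ### Position and momentum -/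

/-- The position operator `q ξ (x) = x ξ(x)` on `{ξ ∈ L² | x ξ(x) ∈ L²}`. -/
def q : Env →ₗ.[ℂ] Env where
  domain :=
    { carrier := {f | MemLp (fun x : ℝ => (x : ℂ) * f x) 2 volume}
      add_mem' := by
        intro f g hf hg
        refine (memLp_congr_ae ?_).mp (MemLp.add hf hg)
        filter_upwards [Lp.coeFn_add f g] with x hx
        rw [hx, Pi.add_apply, Pi.add_apply, mul_add]
      zero_mem' := by
        refine (memLp_congr_ae ?_).mp (MemLp.zero' (ε := ℂ))
        filter_upwards [Lp.coeFn_zero ℂ 2 (volume : Measure ℝ)] with x hx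
        simp
      smul_mem' := by
        intro c f hf
        refine (memLp_congr_ae ?_).mp (MemLp.const_smul hf c)
        filter_upwards [Lp.coeFn_smul c f] with x hx
        simp only [Pi.smul_apply, smul_eq_mul, hx]
        ring }
  toFun :=
    { toFun := fun f => MemLp.toLp (fun x : ℝ => (x : ℂ) * (f : Env) x) f.2
      map_add' := by
        intro f g
        rw [← MemLp.toLp_add]
        refine MemLp.toLp_congr _ _ ?_
        filter_upwards [Lp.coeFn_add (f : Env) g] with x hx
        change (x : ℂ) * ((f : Env) + (g : Env) : Env) x = _
        rw [hx, Pi.add_apply, Pi.add_apply, mul_add]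
      map_smul' := by
        intro c f
        rw [RingHom.id_apply, ← MemLp.toLp_const_smul]
        refine MemLp.toLp_congr _ _ ?_
        filter_upwards [Lp.coeFn_smul c (f : Env)] with x hx
        simp only [SetLike.val_smul, Pi.smul_apply, smul_eq_mul, hx]
        ring }

/-- The embedding of `L²(ℝ)` into the tempered distributions. -/
def toDist : Env →ₗ[ℂ] 𝓢'(ℝ, ℂ) :=
  (Lp.toTemperedDistributionCLM ℂ (volume : Measure ℝ) 2).toLinearMap

theorem toDist_injective : Function.Injective toDist :=
  LinearMap.ker_eq_bot.mp (Lp.ker_toTemperedDistributionCLM_eq_bot (F := ℂ)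
    (μ := (volume : Measure ℝ)) (p := 2))

/-- The maximal realization in `L²(ℝ)` of an operator `T` on tempered distributions: its domain is
`{f ∈ L² | T f ∈ L²}`, and it maps `f` to `T f`. -/
def realization (T : 𝓢'(ℝ, ℂ) →ₗ[ℂ] 𝓢'(ℝ, ℂ)) : Env →ₗ.[ℂ] Env where
  domain := (LinearMap.range toDist).comap (T ∘ₗ toDist)
  toFun := (LinearEquiv.ofInjective toDist toDist_injective).symm.toLinearMap ∘ₗ
    (T ∘ₗ toDist).restrict (fun _ hf => hf)

theorem realization_spec (T : 𝓢'(ℝ, ℂ) →ₗ[ℂ] 𝓢'(ℝ, ℂ)) (f : (realization T).domain) :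
    toDist (realization T f) = T (toDist f) := by
  have := (LinearEquiv.ofInjective toDist toDist_injective).apply_symm_apply
    ((T ∘ₗ toDist).restrict (fun _ hf => hf) f)
  exact congrArg Subtype.val this

/-- The distributional derivative. -/
def ddx : 𝓢'(ℝ, ℂ) →ₗ[ℂ] 𝓢'(ℝ, ℂ) := (TemperedDistribution.derivCLM ℂ).toLinearMap

/-- The momentum operator `p = -i d/dx` on `H¹(ℝ) = {f ∈ L² | f' ∈ L²}`. -/
def p : Env →ₗ.[ℂ] Env := realization ((-Complex.I) • ddx)

/-- The operator `p² = -d²/dx²` on `H²(ℝ) = {f ∈ L² | f'' ∈ L²}`. -/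
def p2 : Env →ₗ.[ℂ] Env := realization (-(ddx ∘ₗ ddx))

/-- The Schwartz space as a subspace of `L²(ℝ)`. -/
def schwartz : Submodule ℂ Env :=
  LinearMap.range (SchwartzMap.toLpCLM ℂ ℂ 2 (volume : Measure ℝ) : 𝓢(ℝ, ℂ) →L[ℂ] Env).toLinearMap

/-- The self-adjoint operator `q + p²`, the closure of `q + p²` on the Schwartz space. -/
def qAddP2 : Env →ₗ.[ℂ] Env := ((q + p2).domRestrict schwartz).closure

/-! ### Operators on the total space -/

/-- The operator `A ⊕ B` on `D(A) ⊕ D(B)`. -/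
def directSum (A B : Env →ₗ.[ℂ] Env) : Total →ₗ.[ℂ] Total where
  domain :=
    { carrier := {ψ | ψ 0 ∈ A.domain ∧ ψ 1 ∈ B.domain}
      add_mem' := fun ha hb => ⟨A.domain.add_mem ha.1 hb.1, B.domain.add_mem ha.2 hb.2⟩
      zero_mem' := ⟨A.domain.zero_mem, B.domain.zero_mem⟩
      smul_mem' := fun c _ ha => ⟨A.domain.smul_mem c ha.1, B.domain.smul_mem c ha.2⟩ }
  toFun :=
    { toFun := fun ψ => WithLp.toLp 2 ![A ⟨(ψ : Total) 0, ψ.2.1⟩, B ⟨(ψ : Total) 1, ψ.2.2⟩]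
      map_add' := by
        intro ψ φ
        ext1 i
        fin_cases i
        · exact A.map_add ⟨(ψ : Total) 0, ψ.2.1⟩ ⟨(φ : Total) 0, φ.2.1⟩
        · exact B.map_add ⟨(ψ : Total) 1, ψ.2.2⟩ ⟨(φ : Total) 1, φ.2.2⟩
      map_smul' := by
        intro c ψ
        ext1 i
        fin_cases i
        · exact A.map_smul c ⟨(ψ : Total) 0, ψ.2.1⟩
        · exact B.map_smul c ⟨(ψ : Total) 1, ψ.2.2⟩ }

/-- The operator `M ⊗ A` on `ℂ² ⊗ D(A)`. -/
def tensorOp (M : QMat) (A : Env →ₗ.[ℂ] Env) : Total →ₗ.[ℂ] Total where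
  domain :=
    { carrier := {ψ | ∀ i, ψ i ∈ A.domain}
      add_mem' := fun ha hb i => A.domain.add_mem (ha i) (hb i)
      zero_mem' := fun _ => A.domain.zero_mem
      smul_mem' := fun c _ ha i => A.domain.smul_mem c (ha i) }
  toFun :=
    { toFun := fun ψ => WithLp.toLp 2 (fun i => ∑ j, M i j • A ⟨(ψ : Total) j, ψ.2 j⟩)
      map_add' := by
        intro ψ φ
        ext1 i
        have h (j : Fin 2) : A ⟨((ψ + φ : _) : Total) j, (ψ + φ).2 j⟩ =
            A ⟨(ψ : Total) j, ψ.2 j⟩ + A ⟨(φ : Total) j, φ.2 j⟩ :=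
          A.map_add ⟨(ψ : Total) j, ψ.2 j⟩ ⟨(φ : Total) j, φ.2 j⟩
        simp only [PiLp.add_apply, h, smul_add, Finset.sum_add_distrib]
      map_smul' := by
        intro c ψ
        ext1 i
        have h (j : Fin 2) : A ⟨((c • ψ : _) : Total) j, (c • ψ).2 j⟩ =
            c • A ⟨(ψ : Total) j, ψ.2 j⟩ :=
          A.map_smul c ⟨(ψ : Total) j, ψ.2 j⟩
        simp only [PiLp.smul_apply, h, smul_comm _ c, Finset.smul_sum, RingHom.id_apply] }

/-- The bounded operator `M ⊗ T` for a bounded `T`. -/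
def tensorCLM (M : QMat) (T : Env →L[ℂ] Env) : Total →L[ℂ] Total :=
  (PiLp.continuousLinearEquiv 2 ℂ (fun _ : Fin 2 => Env)).symm.toContinuousLinearMap ∘L
    ContinuousLinearMap.pi
      (fun i => ∑ j, M i j • (T ∘L PiLp.proj 2 (fun _ : Fin 2 => Env) j))

/-- `M ⊗ 1`. -/
abbrev onQubit (M : QMat) : Total →L[ℂ] Total := tensorCLM M 1

/-- Multiplication by the scalar `c`, on the whole space. -/
def scalarOp {E : Type*} [NormedAddCommGroup E] [InnerProductSpace ℂ E] (c : ℂ) : E →ₗ.[ℂ] E :=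
  (c • (LinearMap.id : E →ₗ[ℂ] E)).toPMap ⊤

/-- `v A v*` on `{ψ | v* ψ ∈ D(A)}`, which is `v D(A)` for unitary `v`. -/
def conjOp {E : Type*} [NormedAddCommGroup E] [InnerProductSpace ℂ E] [CompleteSpace E]
    (v : E →L[ℂ] E) (A : E →ₗ.[ℂ] E) : E →ₗ.[ℂ] E where
  domain := A.domain.comap (star v).toLinearMap
  toFun := v.toLinearMap ∘ₗ A.toFun ∘ₗ (star v).toLinearMap.restrict (fun _ h => h)

/-! ### Unitary groups generated by unbounded operators -/

/-- `U` is the strongly continuous unitary group `t ↦ e^{itA}`: its infinitesimal generator, with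
its domain, is `iA`. -/
structure IsUnitaryGroup {E : Type*} [NormedAddCommGroup E] [InnerProductSpace ℂ E]
    [CompleteSpace E] (A : E →ₗ.[ℂ] E) (U : ℝ → E →L[ℂ] E) : Prop where
  unitary_mem : ∀ t, U t ∈ unitary (E →L[ℂ] E)
  map_zero : U 0 = 1
  map_add : ∀ s t, U (s + t) = U s * U t
  strong_cont : ∀ x, Continuous fun t => U t x
  generator : ∀ x y, (x, y) ∈ A.graph ↔ HasDerivAt (fun t => U t x) (Complex.I • y) 0

open Classical in
/-- `expI A t = e^{itA}`, the unitary group generated by `A`. (Such a group exists exactly when `A`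
is self-adjoint and is then unique; otherwise the value is the junk value `1`.) -/
def expI {E : Type*} [NormedAddCommGroup E] [InnerProductSpace ℂ E] [CompleteSpace E]
    (A : E →ₗ.[ℂ] E) : ℝ → E →L[ℂ] E :=
  if h : ∃ U, IsUnitaryGroup A U then h.choose else fun _ => 1

/-! ### Dynamical decoupling -/

/-- The Pauli matrix `X`. -/
def pauliX : QMat := !![0, 1; 1, 0]

/-- The Pauli matrix `Z`. -/
def pauliZ : QMat := !![1, 0; 0, -1]

/-- A cycle `(v 0, …, v (N-1))` through `V` which reaches each element of `V` the same number of
times. -/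
def IsCycle (V : Set QMat) {N : ℕ} (v : Fin N → QMat) : Prop :=
  0 < N ∧ (∀ k, v k ∈ V) ∧ ∃ m : ℕ, ∀ w ∈ V, Nat.card {k : Fin N // v k = w} = m

/-- For every cycle `(v₁, …, v_N)` through `V`,
`(e^{i t/(nN) v₁ H v₁*} ⋯ e^{i t/(nN) v_N H v_N*})ⁿ → e^{i t (1 ⊗ B)}` strongly as `n → ∞`,
uniformly for `t` in compact intervals: dynamical decoupling works uniformly, with limit `B`. -/
def DecouplesUniformly (V : Set QMat) (H : Total →ₗ.[ℂ] Total) (B : Env →ₗ.[ℂ] Env) : Prop :=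
  ∀ (N : ℕ) (v : Fin N → QMat), IsCycle V v → ∀ (ψ : Total) (a b : ℝ),
    TendstoUniformlyOn
      (fun (n : ℕ) (t : ℝ) =>
        ((List.ofFn fun k => expI (conjOp (onQubit (v k)) H) (t / (n * N))).prod ^ n) ψ)
      (fun t => expI (tensorOp 1 B) t ψ) atTop (Set.Icc a b)

/-- The evolution `v_N U v_N* ⋯ v₁ U v₁*` during one cycle, when the evolution between two
decoupling operations is `U`. -/
def cycleEvolution {N : ℕ} (v : Fin N → QMat) (U : Total →L[ℂ] Total) : Total →L[ℂ] Total :=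
  (List.ofFn fun k => onQubit (v k) * U * star (onQubit (v k))).reverse.prod

/-- The evolution after `n` decoupling cycles of length `N` in total time `t`, under
`e^{-iτH}` with `τ = t / (nN)`. -/
def evolution {N : ℕ} (v : Fin N → QMat) (H : Total →ₗ.[ℂ] Total) (n : ℕ) (t : ℝ) :
    Total →L[ℂ] Total :=
  cycleEvolution v (expI H (-(t / (n * N)))) ^ n

/-- The Hamiltonian `q ⊕ p²`. -/
def ham : Total →ₗ.[ℂ] Total := directSum q p2

/-- `U_n(t)` for the Hamiltonian `q ⊕ p²` and the cycle `(1, X)`. -/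
def Un (n : ℕ) (t : ℝ) : Total →L[ℂ] Total := evolution ![1, pauliX] ham n t

/-! ### Reduced dynamics -/

/-- An orthonormal basis of the environment. -/
def envBasis : HilbertBasis (exists_hilbertBasis ℂ Env).choose ℂ Env :=
  (exists_hilbertBasis ℂ Env).choose_spec.choose

/-- The block `T_{ij}` of an operator on `L² ⊕ L²`. -/
def block (T : Total →L[ℂ] Total) (i j : Fin 2) (x : Env) : Env :=
  T (WithLp.toLp 2 (Pi.single j x)) i

/-- The partial trace over the environment of a trace-class operator:
`(tr_e T)_{ij} = tr T_{ij}`. -/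
def partialTrace (T : Total →L[ℂ] Total) : QMat :=
  fun i j => ∑' k, inner ℂ (envBasis k) (block T i j (envBasis k))

/-- The reduced state `tr_e (U (ρ ⊗ |ξ⟩⟨ξ|) U*)`. -/
def reducedState (U : Total →L[ℂ] Total) (ρ : QMat) (ξ : Env) : QMat :=
  partialTrace (U * tensorCLM ρ (InnerProductSpace.rankOne ℂ ξ ξ) * star U)

/-- Density matrices of the qubit. -/
def IsDensity (ρ : QMat) : Prop := ρ.PosSemidef ∧ ρ.trace = 1

/-- The vector `|+⟩ = (1/√2, 1/√2)`. -/
def plusVec : Fin 2 → ℂ := ![1 / (√2 : ℝ), 1 / (√2 : ℝ)]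

/-- The state `|+⟩⟨+|`. -/
def plusState : QMat := Matrix.vecMulVec plusVec (star plusVec)

/-- The square of the Hilbert-Schmidt norm. -/
def hsNormSq (A : QMat) : ℝ := ∑ i, ∑ j, ‖A i j‖ ^ 2

/-- `⟨+|ρ|+⟩`. -/
def plusFidelity (ρ : QMat) : ℝ := (star plusVec ⬝ᵥ (ρ *ᵥ plusVec)).re

/-- The momentum-space wave function of the Cauchy state. -/
def cauchyAmplitude (γ k : ℝ) : ℝ := √(γ / (2 * Real.pi) * (1 / (k ^ 2 + γ ^ 2 / 4)))

theorem memLp_cauchy (γ : ℝ) :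
    MemLp (fun w : ℝ => ((√(2 * Real.pi) * cauchyAmplitude γ (2 * Real.pi * w) : ℝ) : ℂ)) 2
      volume := by
  have hmeas : Measurable (fun w : ℝ => √(2 * Real.pi) * cauchyAmplitude γ (2 * Real.pi * w)) := by
    unfold cauchyAmplitude
    fun_prop
  refine MemLp.ofReal (f := fun w : ℝ => √(2 * Real.pi) * cauchyAmplitude γ (2 * Real.pi * w)) ?_
  rw [memLp_two_iff_integrable_sq hmeas.aestronglyMeasurable]
  have hpi := Real.pi_pos
  rcases le_or_gt γ 0 with hγ | hγ
  · have : (fun w : ℝ => (√(2 * Real.pi) * cauchyAmplitude γ (2 * Real.pi * w)) ^ 2) =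
        fun _ => 0 := by
      funext w
      have h0 : cauchyAmplitude γ (2 * Real.pi * w) = 0 := by
        unfold cauchyAmplitude
        refine Real.sqrt_eq_zero_of_nonpos (mul_nonpos_of_nonpos_of_nonneg ?_ (by positivity))
        exact div_nonpos_of_nonpos_of_nonneg hγ (by positivity)
      simp [h0]
    rw [this]
    exact integrable_zero _ _ _
  · have hint := (integrable_inv_one_add_sq.comp_mul_left'
      (R := 4 * Real.pi / γ) (by positivity)).const_mul (4 / γ)
    refine hint.congr (Filter.Eventually.of_forall fun w => ?_)
    have hne : (2 * Real.pi * w) ^ 2 + γ ^ 2 / 4 ≠ 0 := by positivity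
    change _ = (√(2 * Real.pi) * cauchyAmplitude γ (2 * Real.pi * w)) ^ 2
    rw [cauchyAmplitude, mul_pow (√(2 * Real.pi)), Real.sq_sqrt (by positivity), Real.sq_sqrt (by positivity)]
    field_simp
    ring

/-- The environment state whose momentum-space wave function
`ξ̂(k) = (2π)^{-1/2} ∫ e^{-ikx} ξ(x) dx` is `cauchyAmplitude γ`. As
`(𝓕 ξ)(w) = ∫ e^{-2πiwx} ξ(x) dx`, this says that `(𝓕 ξ)(w) = (2π)^{1/2} ξ̂(2πw)`. -/
def cauchyState (γ : ℝ) : Env := 𝓕⁻ (memLp_cauchy γ).toLp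

/-- The qubit state after `n` decoupling cycles, starting from `ρ` and the Cauchy state. -/
def qubitState (γ : ℝ) (n : ℕ) (ρ : QMat) (t : ℝ) : QMat := reducedState (Un n t) ρ (cauchyState γ)

end Decoupling

end

open Decoupling

noncomputable section

namespace Decoupling

/-! ### Unitary groups and their generators -/

section UnitaryGroups

variable {E : Type*} [NormedAddCommGroup E] [InnerProductSpace ℂ E] [CompleteSpace E]
  {A B : E →ₗ.[ℂ] E} {U V : ℝ → E →L[ℂ] E}

namespace IsUnitaryGroup

/-! Everything reduces to exact computation in a four-parameter family of unitaries. Each operator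
is unitarily equivalent to multiplication by a real function, or is built from such operators by
sums of blocks, scaling and scalar shifts. Its unitary group can therefore be written down first,
and self-adjointness follows from the group: differentiating inner products along orbits gives
symmetry, and a Duhamel argument shows that a dense invariant subspace of the domain is a core
(`mem_graph_of_core`, `closure_eq_of_core`).

In momentum space `q` is `i d/dk`, so `q + p²` is `e^{ip³/3} q e^{-ip³/3}` on Schwartz functions.
The group of the conjugated operator preserves the Schwartz space, which gives essential
self-adjointness (`qAddP2_eq_conjQ`).

Since `e^{isq} φ(p) = φ(p - s) e^{isq}`, the unitaries `e^{i(ap² + bp + c)} e^{isq}` are closed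
under products, with polynomial laws for products and powers (`metaWeyl_mul`, `metaWeyl_pow`). The
groups of `q`, `p`, `p²` and `q + p²` all lie in this family. All evolutions are block diagonal, so
the factorization of `Un` is a comparison of coefficients in each block. For decoupling, the
coefficients after `n` cycles are polynomials in `1/n` and `t`; at `1/n = 0` they are those of
`e^{i(t/2)(q + p²)}`, and joint continuity makes the convergence uniform on compact intervals.

For the reduced state only the overlap of the two conditional environment vectors matters. The two
blocks differ by a scalar phase and a factor `e^{i(t²/2n)p}`, so the coherence is multiplied by a
phase times the characteristic function of a Cauchy distribution. The qubit undergoes pure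
dephasing, and each error in the statement is a function of that one complex factor. -/

theorem star_eq (h : IsUnitaryGroup A U) (t : ℝ) : star (U t) = U (-t) := by
  have h1 : U t * U (-t) = 1 := by rw [← h.map_add, add_neg_cancel, h.map_zero]
  calc star (U t) = star (U t) * (U t * U (-t)) := by rw [h1, mul_one]
    _ = U (-t) := by rw [← mul_assoc, Unitary.star_mul_self_of_mem (h.unitary_mem t), one_mul]

theorem inner_left (h : IsUnitaryGroup A U) (t : ℝ) (x y : E) :
    inner ℂ (U t x) y = inner ℂ x (U (-t) y) := by
  rw [← h.star_eq, ContinuousLinearMap.star_eq_adjoint, ContinuousLinearMap.adjoint_inner_right]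

theorem inner_map_map (h : IsUnitaryGroup A U) (t : ℝ) (x y : E) :
    inner ℂ (U t x) (U t y) = inner ℂ x y := by
  rw [h.inner_left, ← mul_apply_eq_comp, ← h.map_add, neg_add_cancel, h.map_zero,
    one_apply_eq_self]

theorem norm_map (h : IsUnitaryGroup A U) (t : ℝ) (x : E) : ‖U t x‖ = ‖x‖ := by
  rw [@norm_eq_sqrt_re_inner ℂ, h.inner_map_map, ← @norm_eq_sqrt_re_inner ℂ]

theorem map_add_apply (h : IsUnitaryGroup A U) (s t : ℝ) (x : E) :
    U (s + t) x = U s (U t x) := by rw [h.map_add, mul_apply_eq_comp]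

omit [CompleteSpace E] in
theorem hasDerivAt_map (T : E →L[ℂ] E) {f : ℝ → E} {z : E} {t : ℝ} (hf : HasDerivAt f z t) :
    HasDerivAt (fun s => T (f s)) (T z) t :=
  (T.restrictScalars ℝ).hasFDerivAt.comp_hasDerivAt t hf

theorem hasDerivAt (h : IsUnitaryGroup A U) {x y : E} (hxy : (x, y) ∈ A.graph) (t : ℝ) :
    HasDerivAt (fun s => U s x) (Complex.I • U t y) t := by
  have h0 : HasDerivAt (fun s => U s x) (Complex.I • y) (t - t) := by
    rw [sub_self]; exact (h.generator x y).mp hxy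
  have := hasDerivAt_map (U t) (h0.comp_sub_const t t)
  rw [ContinuousLinearMap.map_smul] at this
  refine this.congr_of_eventuallyEq (Eventually.of_forall fun s => ?_)
  simp only [← h.map_add_apply, add_sub_cancel]

theorem graph_map (h : IsUnitaryGroup A U) {x y : E} (hxy : (x, y) ∈ A.graph) (t : ℝ) :
    (U t x, U t y) ∈ A.graph := by
  rw [h.generator]
  have := hasDerivAt_map (U t) ((h.generator x y).mp hxy)
  rw [ContinuousLinearMap.map_smul] at this
  refine this.congr_of_eventuallyEq (Eventually.of_forall fun s => ?_)
  simp only [← h.map_add_apply, add_comm]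

/-- The inner product of two orbits is constant in time; its derivative at 0 is the symmetry
relation. -/
theorem symmetric (h : IsUnitaryGroup A U) {x y x' y' : E} (hxy : (x, y) ∈ A.graph)
    (hxy' : (x', y') ∈ A.graph) : inner ℂ y x' = inner ℂ x y' := by
  have h1 := (h.hasDerivAt hxy 0).inner ℂ (h.hasDerivAt hxy' 0)
  simp only [h.inner_map_map, h.map_zero, one_apply_eq_self] at h1
  have h2 := h1.unique (hasDerivAt_const (0 : ℝ) (inner ℂ x x'))
  rw [inner_smul_right, inner_smul_left, Complex.conj_I] at h2
  have h3 : Complex.I * (inner ℂ x y' - inner ℂ y x') = 0 := by linear_combination h2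
  exact (sub_eq_zero.mp ((mul_eq_zero.mp h3).resolve_left Complex.I_ne_zero)).symm

/-- The domain of the generator is dense: it contains the averages of the orbits. -/
theorem dense_domain (h : IsUnitaryGroup A U) : Dense (A.domain : Set E) := by
  intro x
  have hc := h.strong_cont x
  have hF (t : ℝ) : HasDerivAt (fun u => ∫ s in (0 : ℝ)..u, U s x) (U t x) t :=
    intervalIntegral.integral_hasDerivAt_right (hc.intervalIntegrable _ _)
      (hc.stronglyMeasurableAtFilter _ _) hc.continuousAt
  have hmem (r : ℝ) : (∫ s in (0 : ℝ)..r, U s x) ∈ A.domain := by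
    -- Applying `U t` to an orbit integral shifts the interval of integration, so the derivative
    -- only sees the two endpoints.
    have key : HasDerivAt (fun t => U t (∫ s in (0 : ℝ)..r, U s x)) (U r x - U 0 x) 0 := by
      have h1 : HasDerivAt (fun t => (∫ s in (0 : ℝ)..(t + r), U s x) - ∫ s in (0 : ℝ)..t, U s x)
          (U r x - U 0 x) 0 := by
        refine HasDerivAt.sub ?_ (hF 0)
        have := hF (0 + r)
        rw [zero_add] at this
        exact HasDerivAt.comp_add_const (f := fun u => ∫ s in (0 : ℝ)..u, U s x) 0 r
          (by rw [zero_add]; exact this)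
      refine h1.congr_of_eventuallyEq (Eventually.of_forall fun t => ?_)
      simp only
      rw [← ContinuousLinearMap.intervalIntegral_comp_comm _ (hc.intervalIntegrable _ _),
        intervalIntegral.integral_interval_sub_left (hc.intervalIntegrable _ _)
          (hc.intervalIntegrable _ _)]
      have := intervalIntegral.integral_comp_add_right (fun s => U s x) (a := 0) (b := r) t
      rw [zero_add, add_comm r] at this
      rw [← this]
      simp only [← h.map_add_apply, add_comm]
    have h2 : U r x - U 0 x = Complex.I • (-Complex.I • (U r x - U 0 x)) := by
      rw [smul_smul]; simp
    rw [h2] at key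
    exact LinearPMap.mem_domain_of_mem_graph ((h.generator _ _).mpr key)
  -- The averages `r⁻¹ ∫₀ʳ U s x` lie in the domain and converge to `x`.
  have hlim : Tendsto (fun r : ℝ => r⁻¹ • ((∫ s in (0 : ℝ)..(0 + r), U s x) -
      ∫ s in (0 : ℝ)..0, U s x)) (𝓝[≠] 0) (𝓝 (U 0 x)) := (hF 0).tendsto_slope_zero
  rw [h.map_zero, one_apply_eq_self] at hlim
  refine mem_closure_of_tendsto hlim (Eventually.of_forall fun r => ?_)
  rw [intervalIntegral.integral_same, sub_zero, zero_add]
  exact (A.domain.restrictScalars ℝ).smul_mem _ (hmem r)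

/-- A dense subspace of the domain that the group leaves invariant determines the generator. -/
theorem mem_graph_of_core (h : IsUnitaryGroup A U) {S : Submodule ℂ E} (hS : Dense (S : Set E))
    (hSA : S ≤ A.domain) (hinv : ∀ t, ∀ x ∈ S, U t x ∈ S) {y z : E}
    (hyz : ∀ x w, x ∈ S → (x, w) ∈ A.graph → inner ℂ z x = inner ℂ y w) : (y, z) ∈ A.graph := by
  rw [h.generator]
  have hc : Continuous fun s => Complex.I • U s z := (h.strong_cont z).const_smul _
  -- The aim is the integrated equation `U t y = y + ∫₀ᵗ i U s z ds`, which yields the derivative at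
  -- 0. It is tested weakly against `S`; invariance of `S` lets the hypothesis be used at `U (-t)
  -- x`.
  set G : ℝ → E := fun t => ∫ s in (0 : ℝ)..t, Complex.I • U s z
  have hG (t : ℝ) : HasDerivAt G (Complex.I • U t z) t :=
    intervalIntegral.integral_hasDerivAt_right (hc.intervalIntegrable _ _)
      (hc.stronglyMeasurableAtFilter _ _) hc.continuousAt
  have key (t : ℝ) : U t y - G t = y := by
    refine hS.eq_of_inner_left ℂ fun x hx => ?_
    obtain ⟨w, hw⟩ := LinearPMap.mem_domain_iff.mp (hSA hx)
    have hd (t : ℝ) : HasDerivAt (fun s => inner ℂ (U s y - G s) x) 0 t := by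
      have h1 : HasDerivAt (fun s => U (-s) x) (-(Complex.I • U (-t) w)) t := by
        have := (h.hasDerivAt hw (-t)).scomp t (hasDerivAt_neg t)
        rw [neg_one_smul] at this
        exact this
      have h2 := (hasDerivAt_const t y).inner ℂ h1
      have h3 := (hG t).inner ℂ (hasDerivAt_const t x)
      have h4 := h2.sub h3
      simp only [← h.inner_left, inner_zero_right, zero_add] at h4
      rw [ContinuousLinearMap.map_zero, inner_zero_left, add_zero] at h4
      have h5 : inner ℂ y (-(Complex.I • U (-t) w)) - inner ℂ (Complex.I • U t z) x = 0 := by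
        rw [inner_neg_right, inner_smul_right, inner_smul_left, h.inner_left,
          hyz _ _ (hinv _ _ hx) (h.graph_map hw (-t)), Complex.conj_I]
        ring
      rw [h5] at h4
      refine h4.congr_of_eventuallyEq (Eventually.of_forall fun s => ?_)
      simp only [inner_sub_left, Pi.sub_apply]
    have := is_const_of_deriv_eq_zero (fun t => (hd t).differentiableAt) (fun t => (hd t).deriv) t 0
    have hG0 : G 0 = 0 := intervalIntegral.integral_same
    rwa [hG0, sub_zero, h.map_zero, one_apply_eq_self] at this
  have h6 : (fun t => U t y) = fun t => G t + y := by
    funext t; exact sub_eq_iff_eq_add'.mp (key t)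
  rw [h6]
  have h7 := (hG 0).add_const y
  rwa [h.map_zero, one_apply_eq_self] at h7

/-- An operator between a core of the generator and the generator has the generator as adjoint. -/
theorem adjoint_eq_of_core (h : IsUnitaryGroup A U) {S : Submodule ℂ E} (hS : Dense (S : Set E))
    (hinv : ∀ t, ∀ x ∈ S, U t x ∈ S) (hSB : S ≤ B.domain) (hBA : B ≤ A) : B.adjoint = A := by
  refine LinearPMap.eq_of_eq_graph ?_
  rw [LinearPMap.adjoint_graph_eq_graph_adjoint (hS.mono hSB)]
  ext ⟨y, z⟩
  rw [Submodule.mem_adjoint_iff]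
  constructor
  · intro hyz
    refine h.mem_graph_of_core hS (hSB.trans hBA.1) hinv fun x w hx hw => ?_
    obtain ⟨w', hw'⟩ := LinearPMap.mem_domain_iff.mp (hSB hx)
    have h1 := A.mem_graph_snd_inj (LinearPMap.le_graph_of_le hBA hw') hw rfl
    subst h1
    have := sub_eq_zero.mp (hyz x w' hw')
    simp only at this
    rw [← inner_conj_symm, ← this, inner_conj_symm]
  · intro hyz a b hab
    rw [sub_eq_zero]
    exact h.symmetric (LinearPMap.le_graph_of_le hBA hab) hyz

/-- The full domain is itself a dense subspace that the group leaves invariant, so the core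
criterion applies with both operators equal. -/
theorem isSelfAdjoint (h : IsUnitaryGroup A U) : IsSelfAdjoint A :=
  h.adjoint_eq_of_core h.dense_domain
    (fun t x hx => by
      obtain ⟨y, hy⟩ := LinearPMap.mem_domain_iff.mp hx
      exact LinearPMap.mem_domain_of_mem_graph (h.graph_map hy t)) le_rfl le_rfl

/-- An operator between a core of the generator and the generator has the generator as closure. -/
theorem closure_eq_of_core (h : IsUnitaryGroup A U) {S : Submodule ℂ E} (hS : Dense (S : Set E))
    (hinv : ∀ t, ∀ x ∈ S, U t x ∈ S) (hSB : S ≤ B.domain) (hBA : B ≤ A) : B.closure = A := by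
  have hA : A.IsClosed := h.isSelfAdjoint.isClosed
  have hB : B.IsClosable := hA.isClosable.leIsClosable hBA
  have hle : B.closure ≤ A := by
    refine LinearPMap.le_of_le_graph ?_
    rw [← hB.graph_closure_eq_closure_graph]
    exact Submodule.topologicalClosure_minimal _ (LinearPMap.le_graph_of_le hBA) hA
  refine le_antisymm hle (LinearPMap.le_of_le_graph ?_)
  let e := (WithLp.linearEquiv 2 ℂ (E × E)).symm
  -- The graph is moved into the Hilbert space product, where a closed subspace equals its double
  -- orthogonal complement.
  let K : Submodule ℂ (WithLp 2 (E × E)) := B.closure.graph.map e.toLinearMap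
  have hK : IsClosed (K : Set (WithLp 2 (E × E))) := by
    have : (K : Set (WithLp 2 (E × E))) = WithLp.ofLp ⁻¹' (B.closure.graph : Set (E × E)) := by
      ext v
      constructor
      · rintro ⟨w, hw, rfl⟩; exact hw
      · intro hv; exact ⟨_, hv, rfl⟩
    rw [this]
    exact hB.closure_isClosed.preimage (WithLp.prod_continuous_ofLp _ _ _)
  have : CompleteSpace K := hK.completeSpace_coe
  rintro ⟨x, y⟩ hxy
  have hmem : e (x, y) ∈ Kᗮᗮ := by
    rw [Submodule.mem_orthogonal]
    intro v hv
    rw [Submodule.mem_orthogonal] at hv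
    -- Orthogonality to the graph over the core is, up to this rotation, the adjoint relation; the
    -- core property then puts the rotated vector in the graph of `A`.
    have hg : (v.snd, -v.fst) ∈ A.graph := by
      refine h.mem_graph_of_core hS (hSB.trans hBA.1) hinv fun c d hc hd => ?_
      obtain ⟨d', hd'⟩ := LinearPMap.mem_domain_iff.mp (hSB hc)
      have h1 := A.mem_graph_snd_inj (LinearPMap.le_graph_of_le hBA hd') hd rfl
      subst h1
      have h2 := hv (e (c, d')) ⟨_, LinearPMap.le_graph_of_le B.le_closure hd', rfl⟩
      rw [← inner_conj_symm, map_eq_zero, WithLp.prod_inner_apply] at h2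
      rw [inner_neg_left]
      exact neg_eq_of_add_eq_zero_right h2
    have := h.symmetric hg hxy
    rw [WithLp.prod_inner_apply]
    rw [inner_neg_left] at this
    change inner ℂ v.fst x + inner ℂ v.snd y = 0
    rw [← this, add_neg_cancel]
  rw [Submodule.orthogonal_orthogonal] at hmem
  obtain ⟨w, hw, hwe⟩ := hmem
  rw [← e.injective hwe]
  exact hw

/-- An operator generates at most one unitary group. -/
theorem unique (hU : IsUnitaryGroup A U) (hV : IsUnitaryGroup A V) : U = V := by
  funext t
  refine ContinuousLinearMap.coeFn_injective
    (Continuous.ext_on hU.dense_domain (U t).continuous (V t).continuous fun x hx => ?_)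
  obtain ⟨y, hy⟩ := LinearPMap.mem_domain_iff.mp hx
  -- By symmetry of the common generator this overlap keeps its initial value `‖x‖²`, which forces
  -- `‖U t x - V t x‖ = 0`.
  have hd (t : ℝ) : HasDerivAt (fun s => inner ℂ (U s x) (V s x)) 0 t := by
    have h1 := (hU.hasDerivAt hy t).inner ℂ (hV.hasDerivAt hy t)
    rw [inner_smul_left, inner_smul_right, hU.symmetric (hU.graph_map hy t) (hV.graph_map hy t),
      Complex.conj_I, neg_mul, add_neg_cancel] at h1
    exact h1
  have hc := is_const_of_deriv_eq_zero (fun t => (hd t).differentiableAt) (fun t => (hd t).deriv) t 0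
  simp only [hU.map_zero, hV.map_zero, one_apply_eq_self] at hc
  have h2 := @norm_sub_sq ℂ _ _ _ _ (U t x) (V t x)
  rw [hc, inner_self_eq_norm_sq, hU.norm_map, hV.norm_map] at h2
  have h3 : ‖U t x - V t x‖ ^ 2 = 0 := by rw [h2]; ring
  exact sub_eq_zero.mp (norm_eq_zero.mp (pow_eq_zero_iff two_ne_zero |>.mp h3))

/-- Uniqueness is what allows the chosen group `expI A` to be replaced by an explicit one wherever
it is computed. -/
theorem expI_eq (h : IsUnitaryGroup A U) : expI A = U := by
  have hex : ∃ U, IsUnitaryGroup A U := ⟨U, h⟩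
  rw [expI, dif_pos hex]
  exact hex.choose_spec.unique h

theorem expI_spec (h : IsUnitaryGroup A U) : IsUnitaryGroup A (expI A) := by
  rwa [h.expI_eq]

/-- The case `c = 0` is excluded because `0 • A` keeps the domain of `A`, whereas the constant group
is generated by zero on the whole space. -/
theorem real_smul (h : IsUnitaryGroup A U) {c : ℝ} (hc : c ≠ 0) :
    IsUnitaryGroup ((c : ℂ) • A) (fun t => U (c * t)) where
  unitary_mem t := h.unitary_mem _
  map_zero := by rw [mul_zero, h.map_zero]
  map_add s t := by rw [mul_add, h.map_add]
  strong_cont x := (h.strong_cont x).comp (continuous_const.mul continuous_id)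
  generator x y := by
    have hc' : (c : ℂ) ≠ 0 := by exact_mod_cast hc
    have h1 : (x, y) ∈ ((c : ℂ) • A).graph ↔ (x, (c : ℂ)⁻¹ • y) ∈ A.graph := by
      simp only [LinearPMap.mem_graph_iff]
      constructor
      · rintro ⟨u, hu, rfl⟩
        exact ⟨u, hu, by rw [LinearPMap.smul_apply, inv_smul_smul₀ hc']⟩
      · rintro ⟨u, hu, hy⟩
        refine ⟨u, hu, ?_⟩
        rw [LinearPMap.smul_apply]
        exact ((inv_smul_eq_iff₀ hc').mp hy.symm).symm
    rw [h1, h.generator]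
    constructor
    · intro hd
      have hd' : HasDerivAt (fun t => U t x) (Complex.I • (c : ℂ)⁻¹ • y) (c * 0) := by
        rwa [mul_zero]
      have := hd'.scomp 0 ((hasDerivAt_id (0 : ℝ)).const_mul c)
      refine this.congr_deriv ?_
      rw [mul_one, ← Complex.coe_smul, smul_comm, smul_comm (c : ℂ) (c : ℂ)⁻¹, inv_smul_smul₀ hc']
    · intro hd
      have hd' : HasDerivAt (fun t => U (c * t) x) (Complex.I • y) (c⁻¹ * 0) := by
        rwa [mul_zero]
      have := hd'.scomp 0 ((hasDerivAt_id (0 : ℝ)).const_mul c⁻¹)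
      convert this using 1
      · funext t
        simp [hc]
      · rw [mul_one, ← Complex.coe_smul, smul_comm, Complex.ofReal_inv]

theorem neg (h : IsUnitaryGroup A U) : IsUnitaryGroup (-A) (fun t => U (-t)) := by
  have h1 := h.real_smul (c := -1) (by norm_num)
  simp only [neg_mul, one_mul] at h1
  convert h1 using 1
  refine LinearPMap.ext rfl fun x h1 h2 => ?_
  rw [LinearPMap.smul_apply, LinearPMap.neg_apply]
  simp

end IsUnitaryGroup

/-! ### Scalar phases and scalar generators -/

theorem hasDerivAt_cexp_mul_I (c : ℝ) :
    HasDerivAt (fun t : ℝ => Complex.exp ((c * t : ℝ) * Complex.I)) (c * Complex.I) 0 := by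
  have h1 : HasDerivAt (fun t : ℝ => ((c * t : ℝ) : ℂ) * Complex.I) (c * Complex.I) 0 := by
    have := ((hasDerivAt_id (0 : ℝ)).const_mul c).ofReal_comp.mul_const Complex.I
    simpa using this
  have := h1.cexp
  simpa using this

theorem exp_mul_I_smul_mem_unitary (r : ℝ) {T : E →L[ℂ] E} (hT : T ∈ unitary (E →L[ℂ] E)) :
    Complex.exp (r * Complex.I) • T ∈ unitary (E →L[ℂ] E) := by
  have h1 : star (Complex.exp (r * Complex.I)) * Complex.exp (r * Complex.I) = 1 := by
    rw [Complex.star_def, ← Complex.exp_conj, ← Complex.exp_add]; simp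
  rw [Unitary.mem_iff, star_smul, smul_mul_smul_comm, smul_mul_smul_comm, mul_comm _ (star _), h1,
    Unitary.star_mul_self_of_mem hT, Unitary.mul_star_self_of_mem hT, one_smul]
  exact ⟨rfl, rfl⟩

omit [CompleteSpace E] in
theorem scalarOp_apply (c : ℂ) (x : (scalarOp c : E →ₗ.[ℂ] E).domain) :
    scalarOp c x = c • (x : E) := rfl

/-- `e^{it(A + c)} = e^{ict} e^{itA}`. -/
theorem IsUnitaryGroup.add_scalarOp (h : IsUnitaryGroup A U) (c : ℝ) :
    IsUnitaryGroup (A + scalarOp (c : ℂ))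
      (fun t => Complex.exp ((c * t : ℝ) * Complex.I) • U t) where
  unitary_mem t := exp_mul_I_smul_mem_unitary _ (h.unitary_mem t)
  map_zero := by simp [h.map_zero]
  map_add s t := by
    rw [h.map_add, smul_mul_smul_comm, ← Complex.exp_add]
    congr 2
    push_cast
    ring
  strong_cont x := by
    have := h.strong_cont x
    simp only [_root_.smul_apply]
    fun_prop
  generator x y := by
    have h1 : (x, y) ∈ (A + scalarOp (c : ℂ)).graph ↔ (x, y - (c : ℂ) • x) ∈ A.graph := by
      simp only [LinearPMap.mem_graph_iff]
      constructor
      · rintro ⟨u, hu, hy⟩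
        refine ⟨⟨u, u.2.1⟩, hu, ?_⟩
        rw [← hy, ← hu, LinearPMap.add_apply, scalarOp_apply]
        simp
      · rintro ⟨u, hu, hy⟩
        refine ⟨⟨u, u.2, trivial⟩, hu, ?_⟩
        rw [LinearPMap.add_apply, scalarOp_apply]
        subst hu
        change A u + (c : ℂ) • (u : E) = y
        rw [hy, sub_add_cancel]
    rw [h1, h.generator]
    constructor
    · intro hd
      refine ((hasDerivAt_cexp_mul_I c).smul hd).congr_deriv ?_
      rw [mul_zero, Complex.ofReal_zero, zero_mul, Complex.exp_zero, one_smul, h.map_zero,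
        one_apply_eq_self, smul_sub, smul_smul, mul_comm Complex.I, sub_add_cancel]
    · intro hd
      have := (hasDerivAt_cexp_mul_I (-c)).smul hd
      refine (this.congr_deriv ?_).congr_of_eventuallyEq (Eventually.of_forall fun t => ?_)
      · rw [mul_zero, mul_zero, Complex.ofReal_zero, zero_mul, Complex.exp_zero, one_smul,
          h.map_zero, one_smul, one_apply_eq_self, smul_sub, smul_smul, mul_comm Complex.I (c : ℂ),
          Complex.ofReal_neg, neg_mul, neg_smul, ← sub_eq_add_neg]
      · simp only [Pi.smul_apply', _root_.smul_apply, smul_smul, ← Complex.exp_add]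
        rw [← add_mul, neg_mul, Complex.ofReal_neg, neg_add_cancel, zero_mul, Complex.exp_zero,
          one_smul]

theorem isUnitaryGroup_zero : IsUnitaryGroup (scalarOp (0 : ℂ) : E →ₗ.[ℂ] E) (fun _ => 1) where
  unitary_mem _ := one_mem _
  map_zero := rfl
  map_add _ _ := (mul_one _).symm
  strong_cont _ := continuous_const
  generator x y := by
    have h1 : (x, y) ∈ (scalarOp (0 : ℂ) : E →ₗ.[ℂ] E).graph ↔ y = 0 := by
      simp only [LinearPMap.mem_graph_iff]
      constructor
      · rintro ⟨u, hu, hy⟩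
        rw [← hy, scalarOp_apply]
        simp
      · rintro rfl
        exact ⟨⟨x, trivial⟩, rfl, by rw [scalarOp_apply]; simp⟩
    rw [h1]
    constructor
    · rintro rfl
      rw [smul_zero]
      exact hasDerivAt_const _ _
    · intro hd
      have := hd.unique (hasDerivAt_const (0 : ℝ) x)
      exact (smul_eq_zero.mp this).resolve_left Complex.I_ne_zero

theorem isUnitaryGroup_scalarOp (c : ℝ) : IsUnitaryGroup (scalarOp (c : ℂ) : E →ₗ.[ℂ] E)
    (fun t => Complex.exp ((c * t : ℝ) * Complex.I) • 1) := by
  have h := (isUnitaryGroup_zero (E := E)).add_scalarOp c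
  convert h using 1
  refine LinearPMap.ext (by ext; simp [LinearPMap.add_domain, scalarOp]) fun x h1 h2 => ?_
  rw [LinearPMap.add_apply]
  simp only [scalarOp_apply]
  simp

end UnitaryGroups

/-! ### Block-diagonal operators -/

/-- The block-diagonal operator `S ⊕ T`. -/
def blockDiag (S T : Env →L[ℂ] Env) : Total →L[ℂ] Total :=
  (PiLp.continuousLinearEquiv 2 ℂ (fun _ : Fin 2 => Env)).symm.toContinuousLinearMap ∘L
    ContinuousLinearMap.pi ![S ∘L PiLp.proj 2 (fun _ : Fin 2 => Env) 0,
      T ∘L PiLp.proj 2 (fun _ : Fin 2 => Env) 1]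

@[simp] theorem blockDiag_apply_zero (S T : Env →L[ℂ] Env) (ψ : Total) :
    blockDiag S T ψ 0 = S (ψ 0) := rfl

@[simp] theorem blockDiag_apply_one (S T : Env →L[ℂ] Env) (ψ : Total) :
    blockDiag S T ψ 1 = T (ψ 1) := rfl

theorem total_ext {ψ φ : Total} (h0 : ψ 0 = φ 0) (h1 : ψ 1 = φ 1) : ψ = φ := by
  ext1 i
  fin_cases i
  · exact h0
  · exact h1

theorem total_op_ext {S T : Total →L[ℂ] Total} (h0 : ∀ ψ, S ψ 0 = T ψ 0)
    (h1 : ∀ ψ, S ψ 1 = T ψ 1) : S = T :=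
  ContinuousLinearMap.ext fun ψ => total_ext (h0 ψ) (h1 ψ)

theorem blockDiag_mul (S T S' T' : Env →L[ℂ] Env) :
    blockDiag S T * blockDiag S' T' = blockDiag (S * S') (T * T') :=
  total_op_ext (fun _ => rfl) fun _ => rfl

theorem blockDiag_one : blockDiag 1 1 = 1 := total_op_ext (fun _ => rfl) fun _ => rfl

theorem smul_blockDiag (c : ℂ) (S T : Env →L[ℂ] Env) :
    c • blockDiag S T = blockDiag (c • S) (c • T) :=
  total_op_ext (fun _ => rfl) fun _ => rfl

theorem blockDiag_pow (S T : Env →L[ℂ] Env) (n : ℕ) :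
    blockDiag S T ^ n = blockDiag (S ^ n) (T ^ n) := by
  induction n with
  | zero => simp only [pow_zero, blockDiag_one]
  | succ n ih => rw [pow_succ, ih, blockDiag_mul, pow_succ, pow_succ]

theorem blockDiag_list_prod (l : List ((Env →L[ℂ] Env) × (Env →L[ℂ] Env))) :
    (l.map fun w => blockDiag w.1 w.2).prod =
      blockDiag (l.map Prod.fst).prod (l.map Prod.snd).prod := by
  induction l with
  | nil => simp only [List.map_nil, List.prod_nil, blockDiag_one]
  | cons w l ih => simp only [List.map_cons, List.prod_cons, ih, blockDiag_mul]

theorem star_blockDiag (S T : Env →L[ℂ] Env) :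
    star (blockDiag S T) = blockDiag (star S) (star T) := by
  refine ((ContinuousLinearMap.eq_adjoint_iff _ _).mpr ?_).symm
  intro ψ φ
  simp only [PiLp.inner_apply, Fin.sum_univ_two, blockDiag_apply_zero, blockDiag_apply_one,
    ContinuousLinearMap.star_eq_adjoint, ContinuousLinearMap.adjoint_inner_left]

theorem continuous_total_iff {α : Type*} [TopologicalSpace α] {f : α → Total} :
    Continuous f ↔ Continuous (fun a => f a 0) ∧ Continuous fun a => f a 1 := by
  rw [← (PiLp.continuousLinearEquiv 2 ℂ (fun _ : Fin 2 => Env)).toHomeomorph.comp_continuous_iff,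
    continuous_pi_iff, Fin.forall_fin_two]
  rfl

theorem hasDerivAt_total_iff {f : ℝ → Total} {z : Total} {t : ℝ} :
    HasDerivAt f z t ↔ HasDerivAt (fun s => f s 0) (z 0) t ∧ HasDerivAt (fun s => f s 1) (z 1) t := by
  have h1 : HasDerivAt f z t ↔ HasDerivAt (fun s => WithLp.ofLp (f s)) (WithLp.ofLp z) t := by
    constructor
    · intro h
      exact (PiLp.continuousLinearEquiv 2 ℝ (fun _ : Fin 2 => Env)).toContinuousLinearMap.hasFDerivAt.comp_hasDerivAt t h
    · intro h
      exact (PiLp.continuousLinearEquiv 2 ℝ (fun _ : Fin 2 => Env)).symm.toContinuousLinearMap.hasFDerivAt.comp_hasDerivAt t h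
  rw [h1, hasDerivAt_pi, Fin.forall_fin_two]

theorem mem_graph_directSum {A B : Env →ₗ.[ℂ] Env} {ψ φ : Total} :
    (ψ, φ) ∈ (directSum A B).graph ↔ (ψ 0, φ 0) ∈ A.graph ∧ (ψ 1, φ 1) ∈ B.graph := by
  simp only [LinearPMap.mem_graph_iff]
  constructor
  · rintro ⟨u, rfl, rfl⟩
    exact ⟨⟨⟨(u : Total) 0, u.2.1⟩, rfl, rfl⟩, ⟨⟨(u : Total) 1, u.2.2⟩, rfl, rfl⟩⟩
  · rintro ⟨⟨u, hu, hu'⟩, ⟨v, hv, hv'⟩⟩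
    refine ⟨⟨ψ, hu ▸ u.2, hv ▸ v.2⟩, rfl, total_ext ?_ ?_⟩
    · rw [← hu']
      exact congrArg A (Subtype.ext hu.symm)
    · rw [← hv']
      exact congrArg B (Subtype.ext hv.symm)

theorem IsUnitaryGroup.directSum {A B : Env →ₗ.[ℂ] Env} {U V : ℝ → Env →L[ℂ] Env}
    (hA : IsUnitaryGroup A U) (hB : IsUnitaryGroup B V) :
    IsUnitaryGroup (directSum A B) (fun t => blockDiag (U t) (V t)) where
  unitary_mem t := by
    rw [Unitary.mem_iff, star_blockDiag, blockDiag_mul, blockDiag_mul,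
      Unitary.star_mul_self_of_mem (hA.unitary_mem t), Unitary.mul_star_self_of_mem (hA.unitary_mem t),
      Unitary.star_mul_self_of_mem (hB.unitary_mem t), Unitary.mul_star_self_of_mem (hB.unitary_mem t),
      blockDiag_one]
    exact ⟨rfl, rfl⟩
  map_zero := by rw [hA.map_zero, hB.map_zero, blockDiag_one]
  map_add s t := by rw [hA.map_add, hB.map_add, blockDiag_mul]
  strong_cont ψ := continuous_total_iff.mpr ⟨hA.strong_cont _, hB.strong_cont _⟩
  generator ψ φ := by
    rw [mem_graph_directSum, hA.generator, hB.generator]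
    exact (hasDerivAt_total_iff (f := fun t => blockDiag (U t) (V t) ψ) (z := Complex.I • φ)).symm

theorem tensorOp_one (A : Env →ₗ.[ℂ] Env) : tensorOp 1 A = directSum A A := by
  refine LinearPMap.ext ?_ fun ψ h1 h2 => total_ext ?_ ?_
  · ext ψ
    exact Fin.forall_fin_two
  · change ∑ j, (1 : QMat) 0 j • A ⟨ψ j, _⟩ = A ⟨ψ 0, _⟩
    simp [Fin.sum_univ_two]
  · change ∑ j, (1 : QMat) 1 j • A ⟨ψ j, _⟩ = A ⟨ψ 1, _⟩
    simp [Fin.sum_univ_two]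

theorem tensorOp_pauliZ (A : Env →ₗ.[ℂ] Env) : tensorOp pauliZ A = directSum A (-A) := by
  refine LinearPMap.ext ?_ fun ψ h1 h2 => total_ext ?_ ?_
  · ext ψ
    exact Fin.forall_fin_two
  · change ∑ j, pauliZ 0 j • A ⟨ψ j, _⟩ = A ⟨ψ 0, _⟩
    simp [Fin.sum_univ_two, pauliZ]
  · change ∑ j, pauliZ 1 j • A ⟨ψ j, _⟩ = -A ⟨ψ 1, _⟩
    simp [Fin.sum_univ_two, pauliZ]

theorem directSum_add_directSum (A B C D : Env →ₗ.[ℂ] Env) :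
    directSum A B + directSum C D = directSum (A + C) (B + D) := by
  refine LinearPMap.ext ?_ fun ψ h1 h2 => total_ext rfl rfl
  ext ψ
  exact and_and_and_comm

theorem tensorCLM_apply (M : QMat) (T : Env →L[ℂ] Env) (ψ : Total) (i : Fin 2) :
    tensorCLM M T ψ i = ∑ j, M i j • T (ψ j) := by
  simp [tensorCLM]

theorem onQubit_one : onQubit 1 = 1 := by
  refine total_op_ext (fun ψ => ?_) fun ψ => ?_ <;> rw [tensorCLM_apply] <;>
  simp [Fin.sum_univ_two]

theorem onQubit_pauliX_apply_zero (ψ : Total) : onQubit pauliX ψ 0 = ψ 1 := by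
  rw [tensorCLM_apply]
  simp [pauliX]

theorem onQubit_pauliX_apply_one (ψ : Total) : onQubit pauliX ψ 1 = ψ 0 := by
  rw [tensorCLM_apply]
  simp [pauliX]

theorem star_onQubit_pauliX : star (onQubit pauliX) = onQubit pauliX := by
  refine ((ContinuousLinearMap.eq_adjoint_iff _ _).mpr ?_).symm
  intro ψ φ
  simp only [PiLp.inner_apply, Fin.sum_univ_two, onQubit_pauliX_apply_zero,
    onQubit_pauliX_apply_one, add_comm]

theorem onQubit_pauliX_conj (S T : Env →L[ℂ] Env) :
    onQubit pauliX * blockDiag S T * star (onQubit pauliX) = blockDiag T S := by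
  rw [star_onQubit_pauliX]
  refine total_op_ext (fun ψ => ?_) fun ψ => ?_ <;>
  simp only [mul_apply_eq_comp, onQubit_pauliX_apply_zero, onQubit_pauliX_apply_one,
    blockDiag_apply_zero, blockDiag_apply_one]

theorem conjOp_one {E : Type*} [NormedAddCommGroup E] [InnerProductSpace ℂ E] [CompleteSpace E]
    (A : E →ₗ.[ℂ] E) : conjOp 1 A = A := by
  refine LinearPMap.ext ?_ fun x h1 h2 => ?_
  · ext x
    simp [conjOp]
  · change A ⟨star (1 : E →L[ℂ] E) x, _⟩ = A ⟨x, _⟩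
    congr 2
    rw [star_one]
    rfl

theorem mem_graph_conjOp {E : Type*} [NormedAddCommGroup E] [InnerProductSpace ℂ E]
    [CompleteSpace E] {v : E →L[ℂ] E} (hv : v ∈ unitary (E →L[ℂ] E)) {A : E →ₗ.[ℂ] E} {x y : E} :
    (x, y) ∈ (conjOp v A).graph ↔ (star v x, star v y) ∈ A.graph := by
  have h1 (z : E) : star v (v z) = z := by
    rw [← mul_apply_eq_comp, Unitary.star_mul_self_of_mem hv, one_apply_eq_self]
  have h2 (z : E) : v (star v z) = z := by
    rw [← mul_apply_eq_comp, Unitary.mul_star_self_of_mem hv, one_apply_eq_self]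
  simp only [LinearPMap.mem_graph_iff]
  constructor
  · rintro ⟨u, rfl, rfl⟩
    exact ⟨⟨star v u, u.2⟩, rfl, (h1 _).symm⟩
  · rintro ⟨u, hu, hy⟩
    refine ⟨⟨x, ?_⟩, rfl, ?_⟩
    · change star v x ∈ A.domain
      rw [← hu]
      exact u.2
    · change v (A ⟨star v x, _⟩) = y
      rw [← h2 y, ← hy]
      congr 2
      exact Subtype.ext hu.symm

theorem onQubit_pauliX_mem_unitary : onQubit pauliX ∈ unitary (Total →L[ℂ] Total) := by
  have : onQubit pauliX * onQubit pauliX = 1 := by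
    refine total_op_ext (fun ψ => ?_) fun ψ => ?_ <;>
    simp only [mul_apply_eq_comp, onQubit_pauliX_apply_zero, onQubit_pauliX_apply_one,
      one_apply_eq_self]
  rw [Unitary.mem_iff, star_onQubit_pauliX, this]
  exact ⟨rfl, rfl⟩

/-- `X` interchanges the two copies of the environment, hence the two blocks. -/
theorem conjOp_pauliX_directSum (A B : Env →ₗ.[ℂ] Env) :
    conjOp (onQubit pauliX) (directSum A B) = directSum B A := by
  refine LinearPMap.eq_of_eq_graph ?_
  ext ⟨ψ, φ⟩
  rw [mem_graph_conjOp onQubit_pauliX_mem_unitary, star_onQubit_pauliX, mem_graph_directSum,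
    mem_graph_directSum, onQubit_pauliX_apply_zero, onQubit_pauliX_apply_zero,
    onQubit_pauliX_apply_one, onQubit_pauliX_apply_one, and_comm]

/-! ### Multiplication by a phase -/

theorem norm_sq_eq_integral (f : Env) : ‖f‖ ^ 2 = ∫ x, ‖f x‖ ^ 2 := by
  have h : ((‖f‖ ^ 2 : ℝ) : ℂ) = ((∫ x, ‖f x‖ ^ 2 : ℝ) : ℂ) := by
    have h1 : inner ℂ f f = ((‖f‖ ^ 2 : ℝ) : ℂ) := by
      rw [inner_self_eq_norm_sq_to_K]; norm_cast
    rw [← h1, L2.inner_def, ← integral_complex_ofReal]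
    refine integral_congr_ae (Eventually.of_forall fun x => ?_)
    simp only [inner_self_eq_norm_sq_to_K]
    norm_cast
  exact_mod_cast h

/-- Dominated convergence in `L²`. -/
theorem tendsto_env_of_dominated {ι : Type*} {l : Filter ι} [l.IsCountablyGenerated]
    {F : ι → Env} {f : Env} {G : ι → ℝ → ℂ} {g : ℝ → ℂ} {b : ℝ → ℝ} (hF : ∀ i, F i =ᵐ[volume] G i)
    (hf : f =ᵐ[volume] g) (hb : MemLp b 2 volume) (hle : ∀ i x, ‖G i x - g x‖ ≤ b x)
    (hlim : ∀ x, Tendsto (fun i => G i x) l (𝓝 (g x))) : Tendsto F l (𝓝 f) := by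
  rw [tendsto_iff_norm_sub_tendsto_zero]
  have hsq : Tendsto (fun i => ‖F i - f‖ ^ 2) l (𝓝 0) := by
    have heq (i : ι) : (fun x => ‖(F i - f : Env) x‖ ^ 2) =ᵐ[volume] fun x => ‖G i x - g x‖ ^ 2 := by
      filter_upwards [Lp.coeFn_sub (F i) f, hF i, hf] with x h1 h2 h3
      rw [h1, Pi.sub_apply, h2, h3]
    have h0 : Tendsto (fun i => ∫ x, ‖G i x - g x‖ ^ 2) l (𝓝 (∫ _ : ℝ, (0 : ℝ))) := by
      refine tendsto_integral_filter_of_dominated_convergence (fun x => b x ^ 2) ?_ ?_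
        hb.integrable_sq ?_
      · refine Eventually.of_forall fun i => ?_
        exact ((Lp.aestronglyMeasurable (F i - f)).norm.pow 2).congr (heq i)
      · refine Eventually.of_forall fun i => Eventually.of_forall fun x => ?_
        rw [Real.norm_of_nonneg (by positivity)]
        exact pow_le_pow_left₀ (norm_nonneg _) (hle i x) 2
      · refine Eventually.of_forall fun x => ?_
        have := ((tendsto_iff_norm_sub_tendsto_zero.mp (hlim x)).pow 2)
        simpa using this
    rw [integral_zero] at h0
    refine h0.congr fun i => ?_
    rw [norm_sq_eq_integral, integral_congr_ae (heq i)]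
  have := hsq.sqrt
  simpa [Real.sqrt_sq (norm_nonneg _)] using this

theorem norm_cexp_mul_I (r : ℝ) : ‖Complex.exp (r * Complex.I)‖ = 1 := by
  rw [Complex.norm_exp_ofReal_mul_I]

theorem memLp_phase (φ : C(ℝ, ℝ)) (f : Env) :
    MemLp (fun x => Complex.exp (φ x * Complex.I) * f x) 2 volume := by
  refine (Lp.memLp f).of_le ?_ (Eventually.of_forall fun x => ?_)
  · exact (Continuous.aestronglyMeasurable (by fun_prop)).mul (Lp.aestronglyMeasurable f)
  · rw [norm_mul, norm_cexp_mul_I, one_mul]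

/-- Multiplication by `e^{iφ}`. -/
def phase (φ : C(ℝ, ℝ)) : Env →L[ℂ] Env :=
  LinearMap.mkContinuous
    { toFun := fun f => (memLp_phase φ f).toLp
      map_add' := by
        intro f g
        rw [← MemLp.toLp_add]
        refine MemLp.toLp_congr _ _ ?_
        filter_upwards [Lp.coeFn_add f g] with x hx
        rw [hx, Pi.add_apply, Pi.add_apply, mul_add]
      map_smul' := by
        intro c f
        rw [RingHom.id_apply, ← MemLp.toLp_const_smul]
        refine MemLp.toLp_congr _ _ ?_
        filter_upwards [Lp.coeFn_smul c f] with x hx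
        simp only [Pi.smul_apply, smul_eq_mul, hx]
        ring } 1 (by
    intro f
    rw [one_mul]
    refine Lp.norm_le_norm_of_ae_le ?_
    filter_upwards [(memLp_phase φ f).coeFn_toLp] with x hx
    change ‖(memLp_phase φ f).toLp _ x‖ ≤ _
    rw [hx, norm_mul, norm_cexp_mul_I, one_mul])

theorem coeFn_phase (φ : C(ℝ, ℝ)) (f : Env) :
    phase φ f =ᵐ[volume] fun x => Complex.exp (φ x * Complex.I) * f x :=
  (memLp_phase φ f).coeFn_toLp

theorem phase_add (φ ψ : C(ℝ, ℝ)) : phase (φ + ψ) = phase φ * phase ψ := by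
  ext1 f
  rw [mul_apply_eq_comp]
  refine Lp.ext ?_
  filter_upwards [coeFn_phase (φ + ψ) f, coeFn_phase φ (phase ψ f), coeFn_phase ψ f] with x h1 h2 h3
  rw [h1, h2, h3, ← mul_assoc, ← Complex.exp_add, ContinuousMap.add_apply, Complex.ofReal_add,
    add_mul]

theorem phase_const (c : ℝ) :
    phase (ContinuousMap.const ℝ c) = Complex.exp (c * Complex.I) • (1 : Env →L[ℂ] Env) := by
  ext1 f
  refine Lp.ext ?_
  rw [_root_.smul_apply, one_apply_eq_self]
  filter_upwards [coeFn_phase (ContinuousMap.const ℝ c) f,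
    Lp.coeFn_smul (Complex.exp (c * Complex.I)) f] with x h1 h2
  rw [h1, h2, Pi.smul_apply, smul_eq_mul, ContinuousMap.const_apply]

theorem phase_zero : phase 0 = 1 := by
  have := phase_const 0
  rwa [Complex.ofReal_zero, zero_mul, Complex.exp_zero, one_smul] at this

theorem star_phase (φ : C(ℝ, ℝ)) : star (phase φ) = phase (-φ) := by
  refine ((ContinuousLinearMap.eq_adjoint_iff _ _).mpr fun f g => ?_).symm
  rw [L2.inner_def, L2.inner_def]
  refine integral_congr_ae ?_
  filter_upwards [coeFn_phase (-φ) f, coeFn_phase φ g] with x h1 h2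
  rw [h1, h2, RCLike.inner_apply, RCLike.inner_apply, map_mul, ← Complex.exp_conj,
    ContinuousMap.neg_apply]
  simp only [Complex.ofReal_neg, map_mul, map_neg, Complex.conj_ofReal, Complex.conj_I, neg_mul_neg]
  ring

theorem phase_mem_unitary (φ : C(ℝ, ℝ)) : phase φ ∈ unitary (Env →L[ℂ] Env) := by
  rw [Unitary.mem_iff, star_phase, ← phase_add, ← phase_add, neg_add_cancel, add_neg_cancel,
    phase_zero]
  exact ⟨rfl, rfl⟩

theorem continuous_phase_smul (φ : C(ℝ, ℝ)) (f : Env) : Continuous fun t : ℝ => phase (t • φ) f := by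
  refine continuous_iff_continuousAt.mpr fun t₀ => ?_
  refine tendsto_env_of_dominated (fun t => coeFn_phase (t • φ) f) (coeFn_phase (t₀ • φ) f)
    (b := fun x => 2 * ‖f x‖) ((Lp.memLp f).norm.const_mul 2) (fun t x => ?_) fun x => ?_
  · refine (norm_sub_le _ _).trans ?_
    rw [norm_mul, norm_mul, norm_cexp_mul_I, norm_cexp_mul_I]
    linarith
  · simp only [ContinuousMap.smul_apply, smul_eq_mul]
    exact Continuous.tendsto (f := fun t : ℝ => Complex.exp ((t * φ x : ℝ) * Complex.I) * f x)
      (by fun_prop) t₀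

/-- This identifies the generator with multiplication by `φ` on its maximal domain. Convergence in
`L²` gives almost everywhere convergence along a subsequence, which determines the derivative;
conversely `|e^{ir} - 1| ≤ |r|` dominates the difference quotients by `|φ f|`. -/
theorem hasDerivAt_phase_smul_iff (φ : C(ℝ, ℝ)) (f g : Env) :
    HasDerivAt (fun t : ℝ => phase (t • φ) f) (Complex.I • g) 0 ↔
      g =ᵐ[volume] fun x => (φ x : ℂ) * f x := by
  rw [hasDerivAt_iff_tendsto_slope_zero]
  set F : ℝ → Env := fun t => t⁻¹ • (phase ((0 + t) • φ) f - phase ((0 : ℝ) • φ) f)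
  set G : ℝ → ℝ → ℂ := fun t x => (t : ℂ)⁻¹ * ((Complex.exp ((t * φ x : ℝ) * Complex.I) - 1) * f x)
  have hF (t : ℝ) : F t =ᵐ[volume] G t := by
    have h0 : F t = (t : ℂ)⁻¹ • (phase (t • φ) f - f) := by
      simp only [F]
      rw [zero_add, zero_smul, phase_zero, one_apply_eq_self, ← Complex.ofReal_inv,
        Complex.coe_smul]
      rfl
    rw [h0]
    filter_upwards [Lp.coeFn_smul (t : ℂ)⁻¹ (phase (t • φ) f - f), Lp.coeFn_sub (phase (t • φ) f) f,
      coeFn_phase (t • φ) f] with x h1 h2 h3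
    rw [h1, Pi.smul_apply, h2, Pi.sub_apply, h3, smul_eq_mul, ContinuousMap.smul_apply, smul_eq_mul]
    simp only [G]
    ring
  have hG (x : ℝ) : Tendsto (fun t => G t x) (𝓝[≠] 0) (𝓝 (Complex.I * (φ x * f x))) := by
    have h1 := ((hasDerivAt_cexp_mul_I (φ x)).mul_const (f x)).tendsto_slope_zero
    have h2 : (φ x : ℂ) * Complex.I * f x = Complex.I * (φ x * f x) := by ring
    rw [h2] at h1
    refine h1.congr fun t => ?_
    simp only [G, mul_zero, Complex.ofReal_zero, zero_mul, Complex.exp_zero, zero_add,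
      Complex.real_smul, Complex.ofReal_inv, mul_comm t]
    ring
  constructor
  · intro h
    -- A sequence of times is needed so that only countably many null sets are discarded and a
    -- subsequence can be extracted.
    have hseq : Tendsto (fun n : ℕ => (1 / ((n : ℝ) + 1))) atTop (𝓝[≠] 0) :=
      tendsto_nhdsWithin_iff.mpr ⟨tendsto_one_div_add_atTop_nhds_zero_nat,
        Eventually.of_forall fun n => by
          simp only [Set.mem_compl_iff, Set.mem_singleton_iff]; positivity⟩
    obtain ⟨ns, hns, hae⟩ := (tendstoInMeasure_of_tendsto_Lp (h.comp hseq)).exists_seq_tendsto_ae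
    have hall : ∀ᵐ x, ∀ n : ℕ, F (1 / ((n : ℝ) + 1)) x = G (1 / ((n : ℝ) + 1)) x :=
      ae_all_iff.mpr fun n => hF _
    filter_upwards [hae, hall, Lp.coeFn_smul Complex.I g] with x h1 h2 h3
    have h4 := (hG x).comp (hseq.comp hns.tendsto_atTop)
    have h5 := tendsto_nhds_unique h1 (h4.congr fun n => (h2 (ns n)).symm)
    rw [h3, Pi.smul_apply, smul_eq_mul] at h5
    exact mul_left_cancel₀ Complex.I_ne_zero h5
  · intro h
    have hg : MemLp (fun x => 2 * ‖(φ x : ℂ) * f x‖) 2 volume :=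
      ((Lp.memLp g).ae_eq h).norm.const_mul 2
    refine tendsto_env_of_dominated hF (g := fun x => Complex.I * (φ x * f x)) ?_ hg
      (fun t x => ?_) hG
    · filter_upwards [h, Lp.coeFn_smul Complex.I g] with x h1 h2
      rw [h2, Pi.smul_apply, smul_eq_mul, h1]
    · have h1 : ‖G t x‖ ≤ ‖(φ x : ℂ) * f x‖ := by
        simp only [G]
        rw [norm_mul, norm_mul, norm_mul, norm_inv, Complex.norm_real, Complex.norm_real]
        have h2 : ‖Complex.exp ((t * φ x : ℝ) * Complex.I) - 1‖ ≤ ‖t‖ * ‖φ x‖ := by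
          rw [← norm_mul, mul_comm _ Complex.I]
          exact Real.norm_exp_I_mul_ofReal_sub_one_le
        -- The bound is required at `t = 0` too, where `0⁻¹ = 0` makes the quotient vanish.
        rcases eq_or_ne t 0 with rfl | ht
        · simp only [norm_zero, inv_zero, zero_mul]
          positivity
        · rw [inv_mul_le_iff₀ (norm_pos_iff.mpr ht), ← mul_assoc]
          exact mul_le_mul_of_nonneg_right h2 (norm_nonneg _)
      refine (norm_sub_le _ _).trans ?_
      rw [norm_mul Complex.I, Complex.norm_I, one_mul]
      linarith

theorem star_mul_mul_mem_unitary {W T : Env →L[ℂ] Env} (hW : W ∈ unitary (Env →L[ℂ] Env))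
    (hT : T ∈ unitary (Env →L[ℂ] Env)) : star W * T * W ∈ unitary (Env →L[ℂ] Env) :=
  mul_mem (mul_mem (Unitary.star_mem hW) hT) hW

/-- The group generated by an operator that is unitarily equivalent to multiplication by `φ`. -/
theorem isUnitaryGroup_conj_phase {W : Env →L[ℂ] Env} (hW : W ∈ unitary (Env →L[ℂ] Env))
    (φ : C(ℝ, ℝ)) {A : Env →ₗ.[ℂ] Env}
    (hA : ∀ f g, (f, g) ∈ A.graph ↔ W g =ᵐ[volume] fun x => (φ x : ℂ) * W f x) :
    IsUnitaryGroup A (fun t => star W * phase (t • φ) * W) where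
  unitary_mem t := star_mul_mul_mem_unitary hW (phase_mem_unitary _)
  map_zero := by rw [zero_smul, phase_zero, mul_one, Unitary.star_mul_self_of_mem hW]
  map_add s t := by
    rw [add_smul, phase_add]
    calc star W * (phase (s • φ) * phase (t • φ)) * W
        = star W * phase (s • φ) * 1 * phase (t • φ) * W := by simp only [mul_assoc, one_mul]
      _ = _ := by rw [← Unitary.mul_star_self_of_mem hW]; simp only [mul_assoc]
  strong_cont f := (star W).continuous.comp (continuous_phase_smul φ (W f))
  generator f g := by
    rw [hA, ← hasDerivAt_phase_smul_iff]
    have h1 (x : Env) : star W (W x) = x := by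
      rw [← mul_apply_eq_comp, Unitary.star_mul_self_of_mem hW, one_apply_eq_self]
    have h2 (x : Env) : W (star W x) = x := by
      rw [← mul_apply_eq_comp, Unitary.mul_star_self_of_mem hW, one_apply_eq_self]
    constructor
    · intro h
      have := IsUnitaryGroup.hasDerivAt_map (star W) h
      rwa [ContinuousLinearMap.map_smul, h1] at this
    · intro h
      have := IsUnitaryGroup.hasDerivAt_map W h
      simp only [mul_apply_eq_comp, h2] at this
      rwa [ContinuousLinearMap.map_smul] at this

/-! ### The position operator -/

theorem mem_graph_q {f g : Env} :
    (f, g) ∈ q.graph ↔ g =ᵐ[volume] fun x => ((ContinuousMap.id ℝ x : ℝ) : ℂ) * f x := by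
  rw [LinearPMap.mem_graph_iff]
  constructor
  · rintro ⟨u, rfl, rfl⟩
    exact MemLp.coeFn_toLp u.2
  · intro h
    have hm : MemLp (fun x : ℝ => (x : ℂ) * f x) 2 volume := (Lp.memLp g).ae_eq h
    exact ⟨⟨f, hm⟩, rfl, Lp.ext ((MemLp.coeFn_toLp hm).trans h.symm)⟩

/-- `e^{itq}`. -/
def expQ (t : ℝ) : Env →L[ℂ] Env := phase (t • ContinuousMap.id ℝ)

theorem isUnitaryGroup_q : IsUnitaryGroup q expQ := by
  have := isUnitaryGroup_conj_phase (one_mem (unitary (Env →L[ℂ] Env))) (ContinuousMap.id ℝ)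
    (A := q) (fun f g => mem_graph_q)
  simp only [star_one, one_mul, mul_one] at this
  exact this

/-! ### The Fourier transform and the momentum operators -/

/-- The Fourier transform as a bounded operator. -/
def four : Env →L[ℂ] Env :=
  (Lp.fourierTransformₗᵢ ℝ ℂ).toContinuousLinearEquiv.toContinuousLinearMap

theorem four_apply (f : Env) : four f = 𝓕 f := rfl

theorem star_four_apply (f : Env) : star four f = 𝓕⁻ f := by
  refine ext_inner_left ℂ fun g => ?_
  rw [ContinuousLinearMap.star_eq_adjoint, ContinuousLinearMap.adjoint_inner_right, four_apply]
  conv_lhs => rw [← FourierTransform.fourier_fourierInv_eq (F := Env) f]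
  rw [Lp.inner_fourier_eq]

theorem four_mem_unitary : four ∈ unitary (Env →L[ℂ] Env) := by
  refine Unitary.mem_iff.mpr ⟨?_, ?_⟩
  · ext1 f
    rw [mul_apply_eq_comp, star_four_apply, four_apply, FourierTransform.fourierInv_fourier_eq,
      one_apply_eq_self]
  · ext1 f
    rw [mul_apply_eq_comp, star_four_apply, four_apply, FourierTransform.fourier_fourierInv_eq,
      one_apply_eq_self]

theorem fourier_toDist (f : Env) : 𝓕 (toDist f) = toDist (four f) :=
  Lp.fourier_toTemperedDistribution_eq f

/-- This passes from an identity of distributions to one of functions almost everywhere. Both sides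
are locally integrable, so real smooth test functions of compact support separate them. -/
theorem smulLeftCLM_toDist_eq_iff {g : ℝ → ℂ} (hg : g.HasTemperateGrowth) (f h : Env) :
    TemperedDistribution.smulLeftCLM ℂ g (toDist f) = toDist h ↔
      h =ᵐ[volume] fun x => g x * f x := by
  have hf (u : 𝓢(ℝ, ℂ)) : TemperedDistribution.smulLeftCLM ℂ g (toDist f) u =
      ∫ x, u x * (g x * f x) := by
    rw [TemperedDistribution.smulLeftCLM_apply_apply]
    refine (Lp.toTemperedDistribution_apply f _).trans (integral_congr_ae ?_)
    refine Eventually.of_forall fun x => ?_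
    simp only [SchwartzMap.smulLeftCLM_apply_apply hg, smul_eq_mul]
    ring
  have hh (u : 𝓢(ℝ, ℂ)) : toDist h u = ∫ x, u x * h x := Lp.toTemperedDistribution_apply h u
  constructor
  · intro heq
    have hloc : LocallyIntegrable (fun x => g x * f x) volume := by
      have h1 : LocallyIntegrable f volume := (Lp.memLp f).locallyIntegrable (by norm_num)
      rw [← locallyIntegrableOn_univ] at h1 ⊢
      exact h1.continuousOn_mul hg.1.continuous.continuousOn isOpen_univ.isLocallyClosed
    refine ae_eq_of_integral_contDiff_smul_eq ((Lp.memLp h).locallyIntegrable (by norm_num)) hloc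
      fun u hu hu' => ?_
    have hg₁ : HasCompactSupport (Complex.ofRealCLM ∘ u) := hu'.comp_left rfl
    have hg₂ : ContDiff ℝ (⊤ : ℕ∞) (Complex.ofRealCLM ∘ u) := by fun_prop
    have := (hh (hg₁.toSchwartzMap hg₂)).symm.trans
      ((DFunLike.congr_fun heq _).symm.trans (hf (hg₁.toSchwartzMap hg₂)))
    simpa using this
  · intro heq
    ext u
    rw [hf, hh]
    refine integral_congr_ae ?_
    filter_upwards [heq] with x hx
    rw [hx]

theorem mem_graph_realization {T : 𝓢'(ℝ, ℂ) →ₗ[ℂ] 𝓢'(ℝ, ℂ)} {f g : Env} :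
    (f, g) ∈ (realization T).graph ↔ T (toDist f) = toDist g := by
  rw [LinearPMap.mem_graph_iff]
  constructor
  · rintro ⟨u, rfl, rfl⟩
    exact (realization_spec T u).symm
  · intro h
    have hm : f ∈ (realization T).domain := ⟨g, h.symm⟩
    exact ⟨⟨f, hm⟩, rfl, toDist_injective ((realization_spec T ⟨f, hm⟩).trans h)⟩

theorem hasTemperateGrowth_ofReal : (fun w : ℝ => (w : ℂ)).HasTemperateGrowth :=
  Function.Complex.hasTemperateGrowth_ofReal

/-- With the kernel `e^{-2πiwx}` a derivative becomes multiplication by `2πiw`; this is the origin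
of the momentum `k = 2πw`. -/
theorem fourier_ddx (T : 𝓢'(ℝ, ℂ)) :
    𝓕 (ddx T) = (2 * Real.pi * Complex.I) •
      TemperedDistribution.smulLeftCLM ℂ (fun w : ℝ => (w : ℂ)) (𝓕 T) := by
  have h1 : ddx T = LineDeriv.lineDerivOp (1 : ℝ) T := by
    ext u
    change T (-SchwartzMap.derivCLM ℂ ℂ u) = T (-LineDeriv.lineDerivOp (1 : ℝ) u)
    congr 2
  rw [h1, TemperedDistribution.fourier_lineDerivOp_eq]
  simp

theorem fourier_injective : Function.Injective (𝓕 : 𝓢'(ℝ, ℂ) → 𝓢'(ℝ, ℂ)) := fun S T h => by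
  rw [← FourierTransform.fourierInv_fourier_eq (F := 𝓢'(ℝ, ℂ)) S, h,
    FourierTransform.fourierInv_fourier_eq]

/-- The momentum `k = 2πw` as a function of the frequency `w`. -/
def wavenumber : C(ℝ, ℝ) := ⟨fun w => 2 * Real.pi * w, by fun_prop⟩

theorem hasTemperateGrowth_wavenumber : (fun w : ℝ => (wavenumber w : ℂ)).HasTemperateGrowth := by
  have : (fun w : ℝ => (wavenumber w : ℂ)) = fun w : ℝ => ((2 * Real.pi : ℝ) : ℂ) * (w : ℂ) := by
    funext w; simp [wavenumber]
  rw [this]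
  exact (Function.HasTemperateGrowth.const _).mul hasTemperateGrowth_ofReal

theorem fourier_neg_I_smul_ddx (T : 𝓢'(ℝ, ℂ)) :
    𝓕 ((-Complex.I) • ddx T) =
      TemperedDistribution.smulLeftCLM ℂ (fun w : ℝ => (wavenumber w : ℂ)) (𝓕 T) := by
  have h2 : (fun w : ℝ => (wavenumber w : ℂ)) = ((2 * Real.pi : ℝ) : ℂ) • fun w : ℝ => (w : ℂ) := by
    funext w; simp [wavenumber]
  rw [FourierTransform.fourier_smul, fourier_ddx, h2,
    TemperedDistribution.smulLeftCLM_smul hasTemperateGrowth_ofReal, smul_smul]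
  have : -Complex.I * (2 * Real.pi * Complex.I) = ((2 * Real.pi : ℝ) : ℂ) := by
    push_cast
    linear_combination (-2 * Real.pi : ℂ) * Complex.I_mul_I
  rw [this]
  rfl

/-- The distributional domain is exactly the maximal domain of multiplication by `k`, so `p` falls
under `isUnitaryGroup_conj_phase`. -/
theorem mem_graph_p {f g : Env} :
    (f, g) ∈ p.graph ↔ four g =ᵐ[volume] fun w => (wavenumber w : ℂ) * four f w := by
  rw [p, mem_graph_realization, ← smulLeftCLM_toDist_eq_iff hasTemperateGrowth_wavenumber,
    ← fourier_toDist, ← fourier_toDist, ← fourier_neg_I_smul_ddx, fourier_injective.eq_iff]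
  rfl

theorem mem_graph_p2 {f g : Env} :
    (f, g) ∈ p2.graph ↔
      four g =ᵐ[volume] fun w => (((wavenumber ^ 2 : C(ℝ, ℝ)) w : ℝ) : ℂ) * four f w := by
  have h1 : -(ddx ∘ₗ ddx) (toDist f) = (-Complex.I) • ddx ((-Complex.I) • ddx (toDist f)) := by
    rw [LinearMap.map_smul, smul_smul, neg_mul_neg, Complex.I_mul_I, neg_one_smul]
    rfl
  have h2 : (fun w : ℝ => (((wavenumber ^ 2 : C(ℝ, ℝ)) w : ℝ) : ℂ)) =
      (fun w : ℝ => (wavenumber w : ℂ)) * fun w : ℝ => (wavenumber w : ℂ) := by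
    funext w
    simp [sq]
  have hw := hasTemperateGrowth_wavenumber
  rw [p2, mem_graph_realization, LinearMap.neg_apply, h1, ← fourier_injective.eq_iff,
    fourier_neg_I_smul_ddx, fourier_neg_I_smul_ddx,
    TemperedDistribution.smulLeftCLM_smulLeftCLM_apply hw hw, ← h2, fourier_toDist, fourier_toDist,
    smulLeftCLM_toDist_eq_iff]
  rw [h2]
  exact hw.mul hw

/-- The Fourier multiplier `e^{iφ(p)}`. -/
def momPhase (φ : C(ℝ, ℝ)) : Env →L[ℂ] Env := star four * phase (φ.comp wavenumber) * four

theorem momPhase_mem_unitary (φ : C(ℝ, ℝ)) : momPhase φ ∈ unitary (Env →L[ℂ] Env) :=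
  star_mul_mul_mem_unitary four_mem_unitary (phase_mem_unitary _)

theorem momPhase_add (φ ψ : C(ℝ, ℝ)) : momPhase (φ + ψ) = momPhase φ * momPhase ψ := by
  have h : (φ + ψ).comp wavenumber = φ.comp wavenumber + ψ.comp wavenumber := rfl
  rw [momPhase, h, phase_add]
  calc _ = star four * phase (φ.comp wavenumber) * 1 * phase (ψ.comp wavenumber) * four := by
        simp only [mul_assoc, one_mul]
    _ = _ := by
        rw [← Unitary.mul_star_self_of_mem four_mem_unitary]
        simp only [mul_assoc, momPhase]

theorem momPhase_const (c : ℝ) :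
    momPhase (ContinuousMap.const ℝ c) = Complex.exp (c * Complex.I) • (1 : Env →L[ℂ] Env) := by
  have h : (ContinuousMap.const ℝ c).comp wavenumber = ContinuousMap.const ℝ c := rfl
  rw [momPhase, h, phase_const, mul_smul_comm, smul_mul_assoc, mul_one,
    Unitary.star_mul_self_of_mem four_mem_unitary]

theorem momPhase_zero : momPhase 0 = 1 := by
  have := momPhase_const 0
  rwa [Complex.ofReal_zero, zero_mul, Complex.exp_zero, one_smul] at this

theorem star_momPhase (φ : C(ℝ, ℝ)) : star (momPhase φ) = momPhase (-φ) := by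
  rw [momPhase, star_mul, star_mul, star_star, star_phase, ← mul_assoc]
  rfl

/-- `e^{itp}`. -/
def expP (t : ℝ) : Env →L[ℂ] Env := momPhase (t • ContinuousMap.id ℝ)

/-- `e^{itp²}`. -/
def expP2 (t : ℝ) : Env →L[ℂ] Env := momPhase (t • ContinuousMap.id ℝ ^ 2)

theorem isUnitaryGroup_p : IsUnitaryGroup p expP :=
  isUnitaryGroup_conj_phase four_mem_unitary wavenumber (A := p) (fun _ _ => mem_graph_p)

theorem isUnitaryGroup_p2 : IsUnitaryGroup p2 expP2 := by
  have h : expP2 = fun t => star four * phase (t • wavenumber ^ 2) * four := by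
    funext t
    have h1 : (t • ContinuousMap.id ℝ ^ 2).comp wavenumber = t • wavenumber ^ 2 := by
      ext w
      simp
    rw [expP2, momPhase, h1]
  rw [h]
  exact isUnitaryGroup_conj_phase four_mem_unitary (wavenumber ^ 2) fun _ _ => mem_graph_p2

/-! ### Schwartz functions -/

theorem toLp_mem_schwartz (F : 𝓢(ℝ, ℂ)) : F.toLp 2 volume ∈ schwartz := ⟨F, rfl⟩

theorem dense_schwartz : Dense (schwartz : Set Env) := by
  have h := SchwartzMap.denseRange_toLpCLM (E := ℝ) (F := ℂ) (p := 2) (μ := volume)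
    ENNReal.ofNat_ne_top
  have h2 : (schwartz : Set Env) =
      Set.range (SchwartzMap.toLpCLM ℝ ℂ 2 (volume : Measure ℝ)) := by
    ext f; rfl
  rw [h2]
  exact h

/-- Every derivative is a power of `i` times the function, hence bounded by 1. It follows that
multiplication by `e^{iφ}` preserves the Schwartz space when `φ` has temperate growth. -/
theorem hasTemperateGrowth_cexp_mul_I :
    (fun y : ℝ => Complex.exp (y * Complex.I)).HasTemperateGrowth := by
  have hd (n : ℕ) : iteratedDeriv n (fun y : ℝ => Complex.exp (y * Complex.I)) =
      fun y : ℝ => Complex.I ^ n * Complex.exp (y * Complex.I) := by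
    induction n with
    | zero => funext y; simp
    | succ n ih =>
      rw [iteratedDeriv_succ, ih]
      funext y
      have h1 : HasDerivAt (fun y : ℝ => (y : ℂ) * Complex.I) Complex.I y := by
        simpa using (hasDerivAt_id y).ofReal_comp.mul_const Complex.I
      rw [(h1.cexp.const_mul (Complex.I ^ n)).deriv]
      ring
  refine ⟨(Complex.ofRealCLM.contDiff.mul contDiff_const).cexp, fun n => ⟨0, 1, fun y => ?_⟩⟩
  rw [norm_iteratedFDeriv_eq_norm_iteratedDeriv, hd, norm_mul, norm_pow, Complex.norm_I, one_pow,
    norm_cexp_mul_I]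
  simp

theorem hasTemperateGrowth_phase {φ : C(ℝ, ℝ)} (hφ : Function.HasTemperateGrowth φ) :
    (fun x => Complex.exp (φ x * Complex.I)).HasTemperateGrowth :=
  hasTemperateGrowth_cexp_mul_I.comp hφ

theorem phase_toLp {φ : C(ℝ, ℝ)} (hφ : Function.HasTemperateGrowth φ) (F : 𝓢(ℝ, ℂ)) :
    phase φ (F.toLp 2 volume) =
      (SchwartzMap.smulLeftCLM ℂ (fun x => Complex.exp (φ x * Complex.I)) F).toLp 2 volume := by
  refine Lp.ext ?_
  filter_upwards [coeFn_phase φ (F.toLp 2 volume), F.coeFn_toLp 2 volume,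
    SchwartzMap.coeFn_toLp (SchwartzMap.smulLeftCLM ℂ (fun x => Complex.exp (φ x * Complex.I)) F) 2
      volume] with x h1 h2 h3
  rw [h1, h2, h3, SchwartzMap.smulLeftCLM_apply_apply (hasTemperateGrowth_phase hφ), smul_eq_mul]

theorem four_toLp (F : 𝓢(ℝ, ℂ)) : four (F.toLp 2 volume) = (𝓕 F).toLp 2 volume :=
  SchwartzMap.toLp_fourier_eq F

theorem star_four_toLp (F : 𝓢(ℝ, ℂ)) : star four (F.toLp 2 volume) = (𝓕⁻ F).toLp 2 volume := by
  rw [star_four_apply, SchwartzMap.toLp_fourierInv_eq]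

theorem hasTemperateGrowth_id : Function.HasTemperateGrowth (ContinuousMap.id ℝ) :=
  Function.HasTemperateGrowth.id

theorem hasTemperateGrowth_smul {φ : C(ℝ, ℝ)} (hφ : Function.HasTemperateGrowth φ) (c : ℝ) :
    Function.HasTemperateGrowth (c • φ : C(ℝ, ℝ)) :=
  (Function.HasTemperateGrowth.const c).mul hφ

/-! ### Boosts translate the momentum -/

/-- Translation by `a`. -/
def translate (a : ℝ) : Env →L[ℂ] Env :=
  (Lp.compMeasurePreservingₗᵢ ℂ (fun x : ℝ => x - a)
    (measurePreserving_sub_right volume a)).toContinuousLinearMap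

theorem coeFn_translate (a : ℝ) (f : Env) : translate a f =ᵐ[volume] fun x => f (x - a) :=
  Lp.coeFn_compMeasurePreserving f (measurePreserving_sub_right volume a)

theorem translate_mul_phase (a : ℝ) (φ : C(ℝ, ℝ)) :
    translate a * phase φ = phase (φ.comp ⟨fun x => x - a, by fun_prop⟩) * translate a := by
  ext1 f
  rw [mul_apply_eq_comp, mul_apply_eq_comp]
  refine Lp.ext ?_
  have h := (measurePreserving_sub_right volume a).quasiMeasurePreserving.ae (coeFn_phase φ f)
  filter_upwards [coeFn_translate a (phase φ f), coeFn_translate a f,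
    coeFn_phase (φ.comp ⟨fun x => x - a, by fun_prop⟩) (translate a f), h] with x h1 h2 h3 h4
  rw [h1, h3, h4, h2]
  rfl

/-- On Schwartz functions the boost is absorbed into the exponential of the Fourier integral;
density and boundedness extend the identity to all of `L²`. -/
theorem four_mul_expQ (s : ℝ) : four * expQ s = translate (s / (2 * Real.pi)) * four := by
  refine ContinuousLinearMap.coeFn_injective (Continuous.ext_on dense_schwartz
    (ContinuousLinearMap.continuous _) (ContinuousLinearMap.continuous _) ?_)
  rintro _ ⟨F, rfl⟩
  have hs := hasTemperateGrowth_smul hasTemperateGrowth_id s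
  change four (phase (s • ContinuousMap.id ℝ) (F.toLp 2 volume)) =
    translate _ (four (F.toLp 2 volume))
  rw [phase_toLp hs, four_toLp, four_toLp]
  refine Lp.ext ?_
  have h := (measurePreserving_sub_right volume (s / (2 * Real.pi))).quasiMeasurePreserving.ae
    ((𝓕 F).coeFn_toLp 2 volume)
  filter_upwards [SchwartzMap.coeFn_toLp (𝓕 (SchwartzMap.smulLeftCLM ℂ
      (fun x => Complex.exp ((s • ContinuousMap.id ℝ) x * Complex.I)) F)) 2 volume,
    coeFn_translate (s / (2 * Real.pi)) ((𝓕 F).toLp 2 volume), h] with w h1 h2 h3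
  rw [h1, h2, h3, SchwartzMap.fourier_coe, SchwartzMap.fourier_coe,
    Real.fourier_real_eq_integral_exp_smul, Real.fourier_real_eq_integral_exp_smul]
  refine integral_congr_ae (Eventually.of_forall fun x => ?_)
  simp only [SchwartzMap.smulLeftCLM_apply_apply (hasTemperateGrowth_phase hs), smul_smul,
    ← Complex.exp_add]
  congr 2
  have hpi : (Real.pi : ℂ) ≠ 0 := by exact_mod_cast Real.pi_ne_zero
  simp only [ContinuousMap.smul_apply, ContinuousMap.id_apply, smul_eq_mul]
  push_cast
  field_simp
  ring

/-- `e^{isq} φ(p) = φ(p - s) e^{isq}`. -/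
theorem expQ_mul_momPhase (s : ℝ) (φ : C(ℝ, ℝ)) :
    expQ s * momPhase φ = momPhase (φ.comp ⟨fun k => k - s, by fun_prop⟩) * expQ s := by
  have hU := four_mem_unitary
  have h1 : expQ s = star four * translate (s / (2 * Real.pi)) * four := by
    rw [mul_assoc, ← four_mul_expQ, ← mul_assoc, Unitary.star_mul_self_of_mem hU, one_mul]
  have h2 : (φ.comp wavenumber).comp ⟨fun x => x - s / (2 * Real.pi), by fun_prop⟩ =
      (φ.comp ⟨fun k => k - s, by fun_prop⟩).comp wavenumber := by
    ext w
    simp only [ContinuousMap.comp_apply, ContinuousMap.coe_mk, wavenumber]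
    congr 1
    have := Real.pi_ne_zero
    field_simp
  calc expQ s * momPhase φ
      = star four * translate (s / (2 * Real.pi)) * (four * star four) *
          phase (φ.comp wavenumber) * four := by
        rw [h1, momPhase]; simp only [mul_assoc]
    _ = star four * (translate (s / (2 * Real.pi)) * phase (φ.comp wavenumber)) * four := by
        rw [Unitary.mul_star_self_of_mem hU, mul_one]; simp only [mul_assoc]
    _ = star four * phase ((φ.comp ⟨fun k => k - s, by fun_prop⟩).comp wavenumber) *
          (translate (s / (2 * Real.pi)) * four) := by
        rw [translate_mul_phase, h2]; simp only [mul_assoc]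
    _ = _ := by rw [← four_mul_expQ, momPhase]; simp only [mul_assoc]

/-! ### The operator `q + p²` -/

theorem hasTemperateGrowth_wavenumber_real : Function.HasTemperateGrowth wavenumber :=
  (Function.HasTemperateGrowth.const (2 * Real.pi)).mul Function.HasTemperateGrowth.id

/-- The phase `c k³`. -/
def cubic (c : ℝ) : C(ℝ, ℝ) := c • ContinuousMap.id ℝ ^ 3

theorem hasTemperateGrowth_cubic_wavenumber (c : ℝ) :
    Function.HasTemperateGrowth ((cubic c).comp wavenumber) :=
  (Function.HasTemperateGrowth.const c).mul (hasTemperateGrowth_wavenumber_real.pow 3)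

/-- `e^{ick³}` as a function of the frequency. -/
def cubicPhase (c w : ℝ) : ℂ := Complex.exp (((cubic c).comp wavenumber w : ℝ) * Complex.I)

theorem hasTemperateGrowth_cubicPhase (c : ℝ) : (cubicPhase c).HasTemperateGrowth :=
  hasTemperateGrowth_phase (hasTemperateGrowth_cubic_wavenumber c)

theorem momPhase_cubic_toLp (c : ℝ) (F : 𝓢(ℝ, ℂ)) :
    momPhase (cubic c) (F.toLp 2 volume) =
      (𝓕⁻ (SchwartzMap.smulLeftCLM ℂ (cubicPhase c) (𝓕 F))).toLp 2 volume := by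
  rw [momPhase, mul_apply_eq_comp, mul_apply_eq_comp, four_toLp,
    phase_toLp (hasTemperateGrowth_cubic_wavenumber c), star_four_toLp]
  rfl

theorem momPhase_cubic_mem_schwartz (c : ℝ) {f : Env} (hf : f ∈ schwartz) :
    momPhase (cubic c) f ∈ schwartz := by
  obtain ⟨F, rfl⟩ := hf
  exact (momPhase_cubic_toLp c F).symm ▸ toLp_mem_schwartz _

theorem expQ_mem_schwartz (s : ℝ) {f : Env} (hf : f ∈ schwartz) : expQ s f ∈ schwartz := by
  obtain ⟨F, rfl⟩ := hf
  exact (phase_toLp (hasTemperateGrowth_smul hasTemperateGrowth_id s) F).symm ▸ toLp_mem_schwartz _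

/-- Multiplication by `x` on Schwartz functions. -/
def mulX : 𝓢(ℝ, ℂ) →L[ℂ] 𝓢(ℝ, ℂ) := SchwartzMap.smulLeftCLM ℂ (fun x : ℝ => (x : ℂ))

/-- Multiplication by `k²` on Schwartz functions of the frequency. -/
def mulK2 : 𝓢(ℝ, ℂ) →L[ℂ] 𝓢(ℝ, ℂ) :=
  SchwartzMap.smulLeftCLM ℂ (fun w : ℝ => (((wavenumber ^ 2 : C(ℝ, ℝ)) w : ℝ) : ℂ))

theorem hasTemperateGrowth_wavenumber_sq :
    (fun w : ℝ => (((wavenumber ^ 2 : C(ℝ, ℝ)) w : ℝ) : ℂ)).HasTemperateGrowth := by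
  have h2 : (fun w : ℝ => (((wavenumber ^ 2 : C(ℝ, ℝ)) w : ℝ) : ℂ)) =
      fun w : ℝ => (wavenumber w : ℂ) ^ 2 := by
    funext w
    simp
  rw [h2]
  exact hasTemperateGrowth_wavenumber.pow 2

theorem toLp_mem_graph_q (F : 𝓢(ℝ, ℂ)) :
    (F.toLp 2 volume, (mulX F).toLp 2 volume) ∈ q.graph := by
  rw [mem_graph_q]
  filter_upwards [F.coeFn_toLp 2 volume, (mulX F).coeFn_toLp 2 volume] with x h1 h2
  rw [h1, h2, mulX, SchwartzMap.smulLeftCLM_apply_apply hasTemperateGrowth_ofReal, smul_eq_mul]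
  rfl

theorem toLp_mem_graph_p2 (F : 𝓢(ℝ, ℂ)) :
    (F.toLp 2 volume, (𝓕⁻ (mulK2 (𝓕 F))).toLp 2 volume) ∈ p2.graph := by
  rw [mem_graph_p2, four_toLp, four_toLp, FourierTransform.fourier_fourierInv_eq]
  filter_upwards [(𝓕 F).coeFn_toLp 2 volume, (mulK2 (𝓕 F)).coeFn_toLp 2 volume] with x h1 h2
  rw [h1, h2, mulK2, SchwartzMap.smulLeftCLM_apply_apply hasTemperateGrowth_wavenumber_sq,
    smul_eq_mul]

/-- Position acts as a derivative in momentum space, up to the factor `-2πi`. -/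
theorem fourier_mulX (F : 𝓢(ℝ, ℂ)) (w : ℝ) :
    -(2 * Real.pi * Complex.I) * (𝓕 (mulX F) : 𝓢(ℝ, ℂ)) w = deriv (𝓕 F : 𝓢(ℝ, ℂ)) w := by
  have h := SchwartzMap.lineDerivOp_fourier_eq F (1 : ℝ)
  have h1 : SchwartzMap.smulLeftCLM ℂ (fun x : ℝ => inner ℝ x (1 : ℝ)) F = mulX F := by
    rw [mulX]
    have : (fun x : ℝ => inner ℝ x (1 : ℝ)) = fun x => x := by funext x; simp
    rw [this]
    exact (SchwartzMap.smulLeftCLM_ofReal ℂ (g := fun x : ℝ => x)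
      Function.HasTemperateGrowth.id F).symm
  rw [h1, FourierTransform.fourier_smul] at h
  have h2 := DFunLike.congr_fun h w
  rw [SchwartzMap.lineDerivOp_apply_eq_fderiv] at h2
  rw [← fderiv_apply_one_eq_deriv, h2]
  rfl

/-- The intertwining relation `q e^{-ip³/3} = e^{-ip³/3} (q + p²)` on Schwartz functions. In
momentum space it is the product rule: differentiating `e^{-ik³/3}` brings down `-ik²`, which `q = i
d/dk` turns into `k²`. -/
theorem mulX_fourierInv_cubicPhase (F : 𝓢(ℝ, ℂ)) :
    mulX (𝓕⁻ (SchwartzMap.smulLeftCLM ℂ (cubicPhase (-(1 / 3))) (𝓕 F))) =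
      𝓕⁻ (SchwartzMap.smulLeftCLM ℂ (cubicPhase (-(1 / 3)))
        (𝓕 (mulX F + 𝓕⁻ (mulK2 (𝓕 F))))) := by
  set c : ℝ := -(1 / 3)
  set M := SchwartzMap.smulLeftCLM ℂ (cubicPhase c) (𝓕 F)
  have hM : ⇑M = cubicPhase c * ⇑(𝓕 F : 𝓢(ℝ, ℂ)) := by
    funext w
    rw [Pi.mul_apply, SchwartzMap.smulLeftCLM_apply_apply (hasTemperateGrowth_cubicPhase c), smul_eq_mul]
  suffices h : 𝓕 (mulX (𝓕⁻ M)) = SchwartzMap.smulLeftCLM ℂ (cubicPhase c)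
      (𝓕 (mulX F + 𝓕⁻ (mulK2 (𝓕 F)))) by
    rw [← h, FourierTransform.fourierInv_fourier_eq]
  ext w
  have hpi : (2 * Real.pi * Complex.I : ℂ) ≠ 0 := by
    simp [Real.pi_ne_zero]
  -- This factor turns both Fourier transforms of `x`-multiples into derivatives.
  refine mul_left_cancel₀ (neg_ne_zero.mpr hpi) ?_
  have hE : HasDerivAt (cubicPhase c)
      (cubicPhase c w * (-(wavenumber w : ℂ) ^ 2 * (2 * Real.pi) * Complex.I)) w := by
    have h1 : HasDerivAt (fun w => (cubic c).comp wavenumber w)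
        (-(wavenumber w) ^ 2 * (2 * Real.pi)) w := by
      have h2 : HasDerivAt (fun w : ℝ => c * (2 * Real.pi * w) ^ 3)
          (c * ((3 : ℕ) * (2 * Real.pi * w) ^ 2 * (2 * Real.pi * 1))) w :=
        (((hasDerivAt_id w).const_mul (2 * Real.pi)).pow 3).const_mul c
      refine h2.congr_deriv ?_
      simp only [wavenumber, ContinuousMap.coe_mk, c]
      push_cast
      ring
    have h3 := (h1.ofReal_comp.mul_const Complex.I).cexp
    refine h3.congr_deriv ?_
    rw [cubicPhase]
    push_cast
    ring
  rw [fourier_mulX, FourierTransform.fourier_fourierInv_eq, hM,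
    (hE.mul ((𝓕 F).hasDerivAt w)).deriv,
    SchwartzMap.smulLeftCLM_apply_apply (hasTemperateGrowth_cubicPhase c), smul_eq_mul,
    FourierTransform.fourier_add, _root_.add_apply, FourierTransform.fourier_fourierInv_eq,
    ← fourier_mulX, mulK2, SchwartzMap.smulLeftCLM_apply_apply hasTemperateGrowth_wavenumber_sq,
    smul_eq_mul, ContinuousMap.pow_apply]
  push_cast
  ring

/-- The operator `q + p²` on its full domain, as `e^{ip³/3} q e^{-ip³/3}`. -/
def conjQ : Env →ₗ.[ℂ] Env := conjOp (momPhase (cubic (1 / 3))) q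

theorem cubic_neg (c : ℝ) : cubic (-c) = -cubic c := neg_smul _ _

/-- `e^{it(q + p²)}`. -/
def expR (t : ℝ) : Env →L[ℂ] Env :=
  momPhase (cubic (1 / 3)) * expQ t * momPhase (cubic (-(1 / 3)))

theorem star_momPhase_cubic (c : ℝ) : star (momPhase (cubic c)) = momPhase (cubic (-c)) := by
  rw [star_momPhase, cubic_neg]

theorem isUnitaryGroup_conjQ : IsUnitaryGroup conjQ expR := by
  have h := isUnitaryGroup_conj_phase (momPhase_mem_unitary (cubic (-(1 / 3))))
    (ContinuousMap.id ℝ) (A := conjQ) (fun f g => by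
      rw [conjQ, mem_graph_conjOp (momPhase_mem_unitary _), star_momPhase_cubic, mem_graph_q])
  simp only [star_momPhase_cubic, neg_neg] at h
  exact h

theorem toLp_mem_graph_conjQ (F : 𝓢(ℝ, ℂ)) :
    (F.toLp 2 volume, (mulX F).toLp 2 volume + (𝓕⁻ (mulK2 (𝓕 F))).toLp 2 volume) ∈
      conjQ.graph := by
  have h0 : (mulX F).toLp 2 volume + (𝓕⁻ (mulK2 (𝓕 F))).toLp 2 volume =
      (mulX F + 𝓕⁻ (mulK2 (𝓕 F))).toLp 2 volume := rfl
  rw [h0, conjQ, mem_graph_conjOp (momPhase_mem_unitary _), star_momPhase_cubic,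
    momPhase_cubic_toLp, momPhase_cubic_toLp, ← mulX_fourierInv_cubicPhase]
  exact toLp_mem_graph_q _

theorem expR_mem_schwartz (t : ℝ) {f : Env} (hf : f ∈ schwartz) : expR t f ∈ schwartz := by
  rw [expR, mul_apply_eq_comp, mul_apply_eq_comp]
  exact momPhase_cubic_mem_schwartz _ (expQ_mem_schwartz _ (momPhase_cubic_mem_schwartz _ hf))

theorem mem_graph_add {A B : Env →ₗ.[ℂ] Env} {f g h : Env} (hA : (f, g) ∈ A.graph)
    (hB : (f, h) ∈ B.graph) : (f, g + h) ∈ (A + B).graph := by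
  rw [LinearPMap.mem_graph_iff] at *
  obtain ⟨u, hu, rfl⟩ := hA
  obtain ⟨v, hv, rfl⟩ := hB
  simp only at hu hv
  subst hu
  refine ⟨⟨u, u.2, hv ▸ v.2⟩, rfl, ?_⟩
  rw [LinearPMap.add_apply]
  congr 2
  exact Subtype.ext hv.symm

theorem schwartz_le_domain : schwartz ≤ (q + p2).domain := by
  rintro _ ⟨F, rfl⟩
  exact LinearPMap.mem_domain_of_mem_graph
    (mem_graph_add (toLp_mem_graph_q F) (toLp_mem_graph_p2 F))

theorem schwartz_le_domain_conjQ : schwartz ≤ conjQ.domain := by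
  rintro _ ⟨F, rfl⟩
  exact LinearPMap.mem_domain_of_mem_graph (toLp_mem_graph_conjQ F)

/-- The intertwining relation is known only on Schwartz functions. They form an invariant core of
`conjQ`, so on all of `D(q) ∩ D(p²)` it is enough to pair with them and use the symmetry of `q` and
`p²` separately. -/
theorem q_add_p2_le_conjQ : q + p2 ≤ conjQ := by
  refine LinearPMap.le_of_le_graph ?_
  rintro ⟨f, g⟩ hfg
  obtain ⟨u, rfl, rfl⟩ := LinearPMap.mem_graph_iff _ |>.mp hfg
  refine isUnitaryGroup_conjQ.mem_graph_of_core dense_schwartz schwartz_le_domain_conjQ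
    (fun t x => expR_mem_schwartz t) fun x w hx hw => ?_
  obtain ⟨F, rfl⟩ := hx
  have h1 := conjQ.mem_graph_snd_inj (toLp_mem_graph_conjQ F) hw rfl
  rw [← h1, LinearPMap.add_apply, inner_add_left, inner_add_right]
  congr 1
  · exact isUnitaryGroup_q.symmetric (LinearPMap.mem_graph q ⟨u, u.2.1⟩) (toLp_mem_graph_q F)
  · exact isUnitaryGroup_p2.symmetric (LinearPMap.mem_graph p2 ⟨u, u.2.2⟩) (toLp_mem_graph_p2 F)

/-- Essential self-adjointness on the Schwartz space: the group of `conjQ` preserves it, because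
cubic phases of `p` and linear phases of `q` do. -/
theorem qAddP2_eq_conjQ : qAddP2 = conjQ :=
  isUnitaryGroup_conjQ.closure_eq_of_core dense_schwartz (fun t _ => expR_mem_schwartz t)
    (le_inf le_rfl schwartz_le_domain) (LinearPMap.domRestrict_le.trans q_add_p2_le_conjQ)

theorem isUnitaryGroup_qAddP2 : IsUnitaryGroup qAddP2 expR := by
  rw [qAddP2_eq_conjQ]
  exact isUnitaryGroup_conjQ

/-- `ℂ² ⊗ 𝒮(ℝ)`. -/
def schwartzTotal : Submodule ℂ Total where
  carrier := {ψ | ψ 0 ∈ schwartz ∧ ψ 1 ∈ schwartz}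
  add_mem' ha hb := ⟨schwartz.add_mem ha.1 hb.1, schwartz.add_mem ha.2 hb.2⟩
  zero_mem' := ⟨schwartz.zero_mem, schwartz.zero_mem⟩
  smul_mem' c _ ha := ⟨schwartz.smul_mem c ha.1, schwartz.smul_mem c ha.2⟩

theorem dense_schwartzTotal : Dense (schwartzTotal : Set Total) := by
  have h : Dense (Set.univ.pi fun _ : Fin 2 => (schwartz : Set Env)) :=
    dense_pi _ fun _ _ => dense_schwartz
  have h2 := h.preimage
    (PiLp.continuousLinearEquiv 2 ℂ (fun _ : Fin 2 => Env)).toHomeomorph.isOpenMap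
  refine h2.mono fun ψ hψ => ?_
  exact ⟨hψ 0 trivial, hψ 1 trivial⟩

theorem directSum_mono {A B A' B' : Env →ₗ.[ℂ] Env} (hA : A ≤ A') (hB : B ≤ B') :
    directSum A B ≤ directSum A' B' := by
  refine LinearPMap.le_of_le_graph ?_
  rintro ⟨ψ, φ⟩ h
  rw [mem_graph_directSum] at h ⊢
  exact ⟨LinearPMap.le_graph_of_le hA h.1, LinearPMap.le_graph_of_le hB h.2⟩

theorem closure_tensorOp_q_add_p2 : (tensorOp 1 (q + p2)).closure = tensorOp 1 qAddP2 := by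
  rw [tensorOp_one, tensorOp_one]
  have hle : q + p2 ≤ qAddP2 := qAddP2_eq_conjQ ▸ q_add_p2_le_conjQ
  refine (isUnitaryGroup_qAddP2.directSum isUnitaryGroup_qAddP2).closure_eq_of_core
    dense_schwartzTotal (fun t ψ hψ => ⟨expR_mem_schwartz t hψ.1, expR_mem_schwartz t hψ.2⟩)
    (fun ψ hψ => ⟨schwartz_le_domain hψ.1, schwartz_le_domain hψ.2⟩) (directSum_mono hle hle)

/-! ### The group generated by `q`, `p` and `p²` -/

/-- The phase `a k² + b k + c`. -/
def quadratic (a b c : ℝ) : C(ℝ, ℝ) := ⟨fun k => a * k ^ 2 + b * k + c, by fun_prop⟩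

/-- `e^{i(ap² + bp + c)} e^{isq}`. -/
def metaWeyl (a b c s : ℝ) : Env →L[ℂ] Env := momPhase (quadratic a b c) * expQ s

/-- Moving `e^{isq}` to the right replaces `k` by `k - s` in the second polynomial, and quadratic
polynomials are stable under translation. -/
theorem metaWeyl_mul (a b c s a' b' c' s' : ℝ) :
    metaWeyl a b c s * metaWeyl a' b' c' s' =
      metaWeyl (a + a') (b + b' - 2 * a' * s) (c + c' - b' * s + a' * s ^ 2) (s + s') := by
  have h : quadratic a b c + (quadratic a' b' c').comp ⟨fun k => k - s, by fun_prop⟩ =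
      quadratic (a + a') (b + b' - 2 * a' * s) (c + c' - b' * s + a' * s ^ 2) := by
    ext k
    simp only [quadratic, ContinuousMap.add_apply, ContinuousMap.comp_apply, ContinuousMap.coe_mk]
    ring
  calc _ = momPhase (quadratic a b c) * (expQ s * momPhase (quadratic a' b' c')) * expQ s' := by
        simp only [metaWeyl, mul_assoc]
    _ = momPhase (quadratic a b c) * momPhase ((quadratic a' b' c').comp
          ⟨fun k => k - s, by fun_prop⟩) * (expQ s * expQ s') := by
        rw [expQ_mul_momPhase]; simp only [mul_assoc]
    _ = _ := by rw [← momPhase_add, h, ← isUnitaryGroup_q.map_add, metaWeyl]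

/-- The `j`-th factor is translated by `js`; the coefficients come from `∑ j` and `∑ j²` over `0 ≤ j
< n`. -/
theorem metaWeyl_pow (a b c s : ℝ) (n : ℕ) :
    metaWeyl a b c s ^ n = metaWeyl (n * a) (n * b - a * s * (n * (n - 1)))
      (n * c - b * s * (n * (n - 1) / 2) + a * s ^ 2 * (n * (n - 1) * (2 * n - 1) / 6)) (n * s) := by
  induction n with
  | zero =>
    have h : quadratic 0 0 0 = 0 := by ext k; simp [quadratic]
    simp only [pow_zero, Nat.cast_zero, zero_mul, zero_div, mul_zero, sub_zero, add_zero]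
    rw [metaWeyl, h, momPhase_zero, isUnitaryGroup_q.map_zero, one_mul]
  | succ n ih =>
    rw [pow_succ, ih, metaWeyl_mul]
    congr 1 <;> push_cast <;> ring

theorem expQ_eq (s : ℝ) : expQ s = metaWeyl 0 0 0 s := by
  have h : quadratic 0 0 0 = 0 := by ext k; simp [quadratic]
  rw [metaWeyl, h, momPhase_zero, one_mul]

theorem expP_eq (t : ℝ) : expP t = metaWeyl 0 t 0 0 := by
  have h : quadratic 0 t 0 = t • ContinuousMap.id ℝ := by ext k; simp [quadratic]
  rw [metaWeyl, h, isUnitaryGroup_q.map_zero, mul_one]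
  rfl

theorem expP2_eq (t : ℝ) : expP2 t = metaWeyl t 0 0 0 := by
  have h : quadratic t 0 0 = t • ContinuousMap.id ℝ ^ 2 := by ext k; simp [quadratic]
  rw [metaWeyl, h, isUnitaryGroup_q.map_zero, mul_one]
  rfl

/-- Commuting `e^{itq}` past one cubic phase leaves `k³/3 - (k - t)³/3`, which is quadratic in `k`.
-/
theorem expR_eq (t : ℝ) : expR t = metaWeyl t (-t ^ 2) (t ^ 3 / 3) t := by
  have h : cubic (1 / 3) + (cubic (-(1 / 3))).comp ⟨fun k => k - t, by fun_prop⟩ =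
      quadratic t (-t ^ 2) (t ^ 3 / 3) := by
    ext k
    simp only [quadratic, cubic, ContinuousMap.add_apply, ContinuousMap.comp_apply,
      ContinuousMap.coe_mk, ContinuousMap.smul_apply, ContinuousMap.pow_apply,
      ContinuousMap.id_apply, smul_eq_mul]
    ring
  rw [expR, mul_assoc, expQ_mul_momPhase, ← mul_assoc, ← momPhase_add, h, metaWeyl]

theorem exp_smul_metaWeyl (r a b c s : ℝ) :
    Complex.exp (r * Complex.I) • metaWeyl a b c s = metaWeyl a b (c + r) s := by
  have h : quadratic a b (c + r) = ContinuousMap.const ℝ r + quadratic a b c := by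
    ext k
    simp only [quadratic, ContinuousMap.add_apply, ContinuousMap.coe_mk, ContinuousMap.const_apply]
    ring
  rw [metaWeyl, metaWeyl, h, momPhase_add, momPhase_const, smul_mul_assoc, one_mul, smul_mul_assoc]

theorem exp_smul_one (r : ℝ) :
    Complex.exp (r * Complex.I) • (1 : Env →L[ℂ] Env) = metaWeyl 0 0 r 0 := by
  rw [← isUnitaryGroup_q.map_zero, expQ_eq, exp_smul_metaWeyl, zero_add]

/-- A strongly continuous unitary group acts jointly continuously. -/
theorem IsUnitaryGroup.continuous_apply {E : Type*} [NormedAddCommGroup E] [InnerProductSpace ℂ E]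
    [CompleteSpace E] {A : E →ₗ.[ℂ] E} {U : ℝ → E →L[ℂ] E} (h : IsUnitaryGroup A U) {α : Type*}
    [TopologicalSpace α] {r : α → ℝ} {f : α → E} (hr : Continuous r) (hf : Continuous f) :
    Continuous fun a => U (r a) (f a) := by
  refine continuous_iff_continuousAt.mpr fun a₀ => ?_
  rw [ContinuousAt, tendsto_iff_norm_sub_tendsto_zero]
  have h1 : Tendsto (fun a => ‖f a - f a₀‖ + ‖U (r a) (f a₀) - U (r a₀) (f a₀)‖) (𝓝 a₀)
      (𝓝 (0 + 0)) :=
    (tendsto_iff_norm_sub_tendsto_zero.mp (hf.tendsto a₀)).add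
      (tendsto_iff_norm_sub_tendsto_zero.mp (((h.strong_cont (f a₀)).comp hr).tendsto a₀))
  rw [add_zero] at h1
  refine squeeze_zero (fun _ => norm_nonneg _) (fun a => ?_) h1
  rw [← h.norm_map (r a) (f a - f a₀), map_sub]
  exact norm_sub_le_norm_sub_add_norm_sub _ _ _

/-- The operator splits into three one-parameter unitary groups and a scalar phase, each acting
jointly continuously. -/
theorem continuous_metaWeyl {α : Type*} [TopologicalSpace α] {a b c s : α → ℝ} (ha : Continuous a)
    (hb : Continuous b) (hc : Continuous c) (hs : Continuous s) (f : Env) :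
    Continuous fun x => metaWeyl (a x) (b x) (c x) (s x) f := by
  have h (x : α) : metaWeyl (a x) (b x) (c x) (s x) f =
      Complex.exp (c x * Complex.I) • expP2 (a x) (expP (b x) (expQ (s x) f)) := by
    rw [← mul_apply_eq_comp, ← mul_apply_eq_comp, ← _root_.smul_apply, expP2_eq, expP_eq, expQ_eq,
      metaWeyl_mul, metaWeyl_mul, exp_smul_metaWeyl]
    simp
  simp only [h]
  have he : Continuous fun x => Complex.exp (c x * Complex.I) := by fun_prop
  refine he.smul ?_
  exact isUnitaryGroup_p2.continuous_apply ha
    (isUnitaryGroup_p.continuous_apply hb (isUnitaryGroup_q.continuous_apply hs continuous_const))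

/-! ### The groups on the total space -/

theorem isUnitaryGroup_ham : IsUnitaryGroup ham (fun t => blockDiag (expQ t) (expP2 t)) :=
  isUnitaryGroup_q.directSum isUnitaryGroup_p2

theorem conjOp_pauliX_ham : conjOp (onQubit pauliX) ham = directSum p2 q :=
  conjOp_pauliX_directSum q p2

theorem conjOp_one_ham : conjOp (onQubit 1) ham = ham := by rw [onQubit_one, conjOp_one]

theorem isUnitaryGroup_conjOp_pauliX_ham :
    IsUnitaryGroup (conjOp (onQubit pauliX) ham) (fun t => blockDiag (expP2 t) (expQ t)) := by
  rw [conjOp_pauliX_ham]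
  exact isUnitaryGroup_p2.directSum isUnitaryGroup_q

theorem isUnitaryGroup_tensorOp_one {A : Env →ₗ.[ℂ] Env} {U : ℝ → Env →L[ℂ] Env}
    (h : IsUnitaryGroup A U) : IsUnitaryGroup (tensorOp 1 A) (fun t => blockDiag (U t) (U t)) := by
  rw [tensorOp_one]
  exact h.directSum h

theorem isUnitaryGroup_tensorOp_pauliZ {A : Env →ₗ.[ℂ] Env} {U : ℝ → Env →L[ℂ] Env}
    (h : IsUnitaryGroup A U) :
    IsUnitaryGroup (tensorOp pauliZ A) (fun t => blockDiag (U t) (U (-t))) := by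
  rw [tensorOp_pauliZ]
  exact h.directSum h.neg

theorem isUnitaryGroup_half_qAddP2 :
    IsUnitaryGroup ((1 / 2 : ℂ) • qAddP2) (fun t => expR (1 / 2 * t)) := by
  have h := isUnitaryGroup_qAddP2.real_smul (c := 1 / 2) (by norm_num)
  have h1 : ((1 / 2 : ℝ) : ℂ) = 1 / 2 := by push_cast; rfl
  rwa [h1] at h

theorem ham_add_conjOp_ham : ham + conjOp (onQubit pauliX) ham = tensorOp 1 (q + p2) := by
  rw [conjOp_pauliX_ham, tensorOp_one, ham, directSum_add_directSum, add_comm p2 q]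

/-! ### The factorized form of the evolution -/

/-- Conjugation by `X` gives the two blocks the same pair of pulses in opposite order. -/
theorem Un_eq (n : ℕ) (t : ℝ) :
    Un n t = blockDiag ((expP2 (-(t / (n * 2))) * expQ (-(t / (n * 2)))) ^ n)
      ((expQ (-(t / (n * 2))) * expP2 (-(t / (n * 2)))) ^ n) := by
  have h : cycleEvolution ![1, pauliX] (expI ham (-(t / (n * 2)))) =
      blockDiag (expP2 (-(t / (n * 2))) * expQ (-(t / (n * 2))))
        (expQ (-(t / (n * 2))) * expP2 (-(t / (n * 2)))) := by
    rw [isUnitaryGroup_ham.expI_eq, cycleEvolution, List.ofFn_succ, List.ofFn_succ, List.ofFn_zero]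
    simp only [Matrix.cons_val_zero, Fin.succ_zero_eq_one, Matrix.cons_val_one, List.reverse_cons,
      List.reverse_nil, List.nil_append, List.cons_append, List.prod_cons, List.prod_nil, mul_one]
    rw [onQubit_pauliX_conj, onQubit_one, star_one, one_mul, mul_one, blockDiag_mul]
  -- The cycle length is inferred from the vector literal and appears as an iterated successor.
  have h2 : ((Nat.succ 0).succ : ℝ) = 2 := by norm_num
  rw [Un, evolution, h2, h, blockDiag_pow]

theorem Un_zero_block {n : ℕ} (hn : 0 < n) (t : ℝ) :
    (expP2 (-(t / (n * 2))) * expQ (-(t / (n * 2)))) ^ n =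
      metaWeyl (-(t / 2)) (-(t ^ 2 / 4) + t ^ 2 / (4 * n))
        (-(t ^ 3 / 24) + t ^ 3 / (16 * n) - t ^ 3 / (48 * n ^ 2)) (-(t / 2)) := by
  have hn' : (n : ℝ) ≠ 0 := by positivity
  rw [expP2_eq, expQ_eq, metaWeyl_mul, metaWeyl_pow]
  congr 1 <;> field_simp <;> ring

/-- Reversing the pulse order only flips the sign of the `1/n` terms. These become the two `Z`
factors of the evolution, while the terms of even order in `1/n` are common to both blocks. -/
theorem Un_one_block {n : ℕ} (hn : 0 < n) (t : ℝ) :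
    (expQ (-(t / (n * 2))) * expP2 (-(t / (n * 2)))) ^ n =
      metaWeyl (-(t / 2)) (-(t ^ 2 / 4) - t ^ 2 / (4 * n))
        (-(t ^ 3 / 24) - t ^ 3 / (16 * n) - t ^ 3 / (48 * n ^ 2)) (-(t / 2)) := by
  have hn' : (n : ℝ) ≠ 0 := by positivity
  rw [expP2_eq, expQ_eq, metaWeyl_mul, metaWeyl_pow]
  congr 1 <;> field_simp <;> ring

theorem isUnitaryGroup_qAddP2_add_scalarOp (c : ℝ) :
    IsUnitaryGroup (tensorOp 1 qAddP2 + scalarOp (c : ℂ))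
      (fun t => Complex.exp ((c * t : ℝ) * Complex.I) • blockDiag (expR t) (expR t)) :=
  (isUnitaryGroup_tensorOp_one isUnitaryGroup_qAddP2).add_scalarOp c

theorem isUnitaryGroup_pauliZ_one :
    IsUnitaryGroup (tensorOp pauliZ (scalarOp 1)) (fun t =>
      blockDiag (Complex.exp ((1 * t : ℝ) * Complex.I) • 1)
        (Complex.exp ((1 * -t : ℝ) * Complex.I) • 1)) := by
  have := isUnitaryGroup_tensorOp_pauliZ (isUnitaryGroup_scalarOp (E := Env) 1)
  rwa [Complex.ofReal_one] at this

/-- The common phase `-t³/(48n²)` is `-(t/2)` times the scalar `t²/(24n²)` added to `q + p²`.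
Commuting `e^{-i(t/2)q}` past the last factor also contributes to the phase, as `metaWeyl_mul`
records. -/
theorem Un_factorization {n : ℕ} (hn : 0 < n) (t : ℝ) :
    Un n t =
      expI (tensorOp 1 qAddP2 + scalarOp ((t ^ 2 / (24 * n ^ 2) : ℝ) : ℂ)) (-(t / 2)) *
      expI (tensorOp pauliZ (scalarOp 1)) (-(t ^ 3 / (16 * n))) *
      expI (tensorOp pauliZ p) (t ^ 2 / (4 * n)) := by
  have hn' : (n : ℝ) ≠ 0 := by positivity
  rw [Un_eq, Un_zero_block hn, Un_one_block hn, (isUnitaryGroup_qAddP2_add_scalarOp _).expI_eq,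
    isUnitaryGroup_pauliZ_one.expI_eq, (isUnitaryGroup_tensorOp_pauliZ isUnitaryGroup_p).expI_eq]
  simp only [smul_blockDiag, blockDiag_mul, exp_smul_one, expR_eq, exp_smul_metaWeyl, expP_eq,
    metaWeyl_mul]
  congr 2 <;> field_simp <;> ring

/-! ### Uniform decoupling -/

/-- `e^{iτp²}` or `e^{iτq}`. -/
def pulse (τ : ℝ) (b : Bool) : Env →L[ℂ] Env := if b then expP2 τ else expQ τ

/-- Give the coefficients `a, b, c, s` the degrees 1, 2, 3, 1 in `τ`: the product law is
homogeneous. Only `β` and `δ` depend on the order of the pulses, and they drop out of the limit. -/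
theorem exists_prod_pulse_eq (l : List Bool) : ∃ β δ : ℝ, ∀ τ : ℝ,
    (l.map (pulse τ)).prod =
      metaWeyl (l.count true * τ) (β * τ ^ 2) (δ * τ ^ 3) (l.count false * τ) := by
  induction l with
  | nil =>
    refine ⟨0, 0, fun τ => ?_⟩
    simp only [List.map_nil, List.prod_nil, List.count_nil, Nat.cast_zero, zero_mul]
    rw [← expQ_eq, isUnitaryGroup_q.map_zero]
  | cons b l ih =>
    obtain ⟨β, δ, h⟩ := ih
    cases b with
    | true =>
      refine ⟨β, δ, fun τ => ?_⟩
      rw [List.map_cons, List.prod_cons, h, pulse, if_pos rfl, expP2_eq, metaWeyl_mul,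
        List.count_cons_self, List.count_cons_of_ne (by decide)]
      congr 1 <;> push_cast <;> ring
    | false =>
      refine ⟨β - 2 * l.count true, δ - β + l.count true, fun τ => ?_⟩
      rw [List.map_cons, List.prod_cons, h, pulse, if_neg (by decide), expQ_eq, metaWeyl_mul,
        List.count_cons_self, List.count_cons_of_ne (by decide)]
      congr 1 <;> push_cast <;> ring

/-- The second coefficient of `n` cycles of total time `t`, as a function of `ε = 1/n`. -/
def cycleLinear (β N ε t : ℝ) : ℝ := β * ε * (t / N) ^ 2 - t ^ 2 / 4 * (1 - ε)

/-- The last coefficient of `n` cycles of total time `t`, as a function of `ε = 1/n`. -/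
def cycleConst (β δ N ε t : ℝ) : ℝ :=
  δ * ε ^ 2 * (t / N) ^ 3 - β * (t / N) ^ 2 * (t / 2) * ((ε - ε ^ 2) / 2) +
    t ^ 3 / 8 * ((1 - ε) * (2 - ε) / 6)

/-- Both pulses occur `m` times in a cycle of length `2m`, so the outer coefficients are `t/2` for
every `n`. -/
theorem cycle_pow_eq (β δ t : ℝ) {m n : ℕ} (hm : 0 < m) (hn : 0 < n) :
    metaWeyl (m * (t / (n * (m + m : ℕ)))) (β * (t / (n * (m + m : ℕ))) ^ 2)
      (δ * (t / (n * (m + m : ℕ))) ^ 3) (m * (t / (n * (m + m : ℕ)))) ^ n =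
    metaWeyl (t / 2) (cycleLinear β (m + m : ℕ) (1 / n) t)
      (cycleConst β δ (m + m : ℕ) (1 / n) t) (t / 2) := by
  have hn' : (n : ℝ) ≠ 0 := by positivity
  have hm' : (m : ℝ) ≠ 0 := by positivity
  rw [metaWeyl_pow]
  push_cast
  simp only [← two_mul, cycleLinear, cycleConst]
  congr 1 <;> field_simp <;> ring

/-- At `ε = 0` the order-dependent terms vanish and `t/2, -t²/4, t³/24, t/2` remain, the
coefficients of `expR` at time `t/2`. -/
theorem cycle_limit (β δ N t : ℝ) :
    metaWeyl (t / 2) (cycleLinear β N 0 t) (cycleConst β δ N 0 t) (t / 2) = expR (1 / 2 * t) := by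
  rw [expR_eq]
  simp only [cycleLinear, cycleConst]
  congr 1 <;> ring

theorem one_ne_pauliX : (1 : QMat) ≠ pauliX := by
  intro h
  have := congrFun (congrFun h 0) 0
  simp [pauliX] at this

theorem count_ofFn_decide {N : ℕ} (P : Fin N → Prop) [DecidablePred P] (b : Bool) :
    (List.ofFn fun k => decide (P k)).count b = Nat.card {k // decide (P k) = b} := by
  rw [List.ofFn_eq_map, List.count_eq_countP, List.countP_map, List.countP_eq_length_filter,
    Nat.card_eq_fintype_card, Fintype.card_subtype]
  have h : (Finset.univ.filter fun k => decide (P k) = b) =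
      ((List.finRange N).filter ((fun x => x == b) ∘ fun k => decide (P k))).toFinset := by
    ext k
    simp
  rw [h, List.toFinset_card_of_nodup ((List.nodup_finRange N).filter _)]

/-- Currying makes `ε ↦ g (ε, ·)` continuous into the compact-open topology, where convergence means
uniform convergence on compact sets. -/
theorem tendstoUniformlyOn_Icc_of_continuous {g : ℝ × ℝ → Total} (hg : Continuous g) (a b : ℝ) :
    TendstoUniformlyOn (fun (n : ℕ) t => g (1 / n, t)) (fun t => g (0, t)) atTop (Set.Icc a b) := by
  have h1 : Tendsto (fun n : ℕ => (ContinuousMap.mk g hg).curry (1 / (n : ℝ))) atTop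
      (𝓝 ((ContinuousMap.mk g hg).curry 0)) :=
    ((ContinuousMap.mk g hg).curry.continuous.tendsto 0).comp tendsto_one_div_atTop_nhds_zero_nat
  exact ContinuousMap.tendsto_iff_forall_isCompact_tendstoUniformlyOn.mp h1 _ isCompact_Icc

theorem decouplesUniformly : DecouplesUniformly {1, pauliX} ham ((1 / 2 : ℂ) • qAddP2) := by
  classical
  rintro N v ⟨hN, hV, m, hm⟩ ψ a b
  -- The Boolean says whether the first block receives `p²` (at `X`) or `q` (at `1`); the second
  -- block receives the opposite pulse.
  set c : Fin N → Bool := fun k => decide (v k = pauliX)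
  have hfalse (k : Fin N) : c k = false ↔ v k = 1 := by
    simp only [c, decide_eq_false_iff_not]
    rcases hV k with h | h
    · simp [h, one_ne_pauliX]
    · have h' : v k = pauliX := h
      simp [h', one_ne_pauliX.symm]
  have htrue (k : Fin N) : c k = true ↔ v k = pauliX := decide_eq_true_iff
  have hct : (List.ofFn c).count true = m := by
    rw [count_ofFn_decide, ← hm pauliX (by simp)]
    exact Nat.card_congr (Equiv.subtypeEquivRight htrue)
  have hcf : (List.ofFn c).count false = m := by
    rw [count_ofFn_decide, ← hm 1 (by simp)]
    exact Nat.card_congr (Equiv.subtypeEquivRight hfalse)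
  have hNm : N = m + m := by
    have h := List.count_true_add_count_false (List.ofFn c)
    rw [hct, hcf, List.length_ofFn] at h
    exact h.symm
  have hm0 : 0 < m := by omega
  have hcn (bb : Bool) : ((List.ofFn c).map not).count bb = m := by
    rw [← Bool.not_not bb, List.count_map_of_injective _ _ Bool.not_injective]
    cases bb
    · exact hct
    · exact hcf
  obtain ⟨β₀, δ₀, h₀⟩ := exists_prod_pulse_eq (List.ofFn c)
  obtain ⟨β₁, δ₁, h₁⟩ := exists_prod_pulse_eq ((List.ofFn c).map not)
  simp only [hct, hcf, hcn] at h₀ h₁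
  have hprod (τ : ℝ) : (List.ofFn fun k => expI (conjOp (onQubit (v k)) ham) τ).prod =
      blockDiag (metaWeyl (m * τ) (β₀ * τ ^ 2) (δ₀ * τ ^ 3) (m * τ))
        (metaWeyl (m * τ) (β₁ * τ ^ 2) (δ₁ * τ ^ 3) (m * τ)) := by
    have h2 (k : Fin N) : expI (conjOp (onQubit (v k)) ham) τ =
        blockDiag (pulse τ (c k)) (pulse τ (!c k)) := by
      rcases hb : c k with _ | _
      · rw [(hfalse k).mp hb, conjOp_one_ham, isUnitaryGroup_ham.expI_eq]
        rfl
      · rw [(htrue k).mp hb, isUnitaryGroup_conjOp_pauliX_ham.expI_eq]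
        rfl
    have h3 : (List.ofFn fun k => expI (conjOp (onQubit (v k)) ham) τ) =
        ((List.ofFn c).map fun bb => (pulse τ bb, pulse τ (!bb))).map
          fun w => blockDiag w.1 w.2 := by
      rw [List.map_map, List.map_ofFn]
      congr 1
      funext k
      exact h2 k
    rw [h3, blockDiag_list_prod, List.map_map, List.map_map, ← h₀, ← h₁, List.map_map]
    rfl
  -- The parameters are `x = (ε, t)` with `ε = 1/n` extended to `ε = 0`, where the limit sits.
  let T (β δ : ℝ) (x : ℝ × ℝ) : Env →L[ℂ] Env :=
    metaWeyl (x.2 / 2) (cycleLinear β (m + m : ℕ) x.1 x.2)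
      (cycleConst β δ (m + m : ℕ) x.1 x.2) (x.2 / 2)
  have hT (β δ : ℝ) (f : Env) : Continuous fun x => T β δ x f := by
    refine continuous_metaWeyl (by fun_prop) ?_ ?_ (by fun_prop) f
    · unfold cycleLinear; fun_prop
    · unfold cycleConst; fun_prop
  have hgc : Continuous fun x => blockDiag (T β₀ δ₀ x) (T β₁ δ₁ x) ψ :=
    continuous_total_iff.mpr ⟨hT β₀ δ₀ (ψ 0), hT β₁ δ₁ (ψ 1)⟩
  have hlim : (fun t => expI (tensorOp 1 ((1 / 2 : ℂ) • qAddP2)) t ψ) =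
      fun t => blockDiag (T β₀ δ₀ (0, t)) (T β₁ δ₁ (0, t)) ψ := by
    funext t
    rw [(isUnitaryGroup_tensorOp_one isUnitaryGroup_half_qAddP2).expI_eq]
    simp only [T, cycle_limit]
  rw [hlim]
  refine (tendstoUniformlyOn_Icc_of_continuous hgc a b).congr ?_
  filter_upwards [eventually_gt_atTop 0] with n hn t _
  simp only [T]
  rw [hprod, blockDiag_pow, hNm, cycle_pow_eq β₀ δ₀ t hm0 hn, cycle_pow_eq β₁ δ₁ t hm0 hn]

/-! ### The characteristic function of the Cauchy state -/

theorem integrable_exp_neg_mul_abs {a : ℝ} (ha : 0 < a) :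
    Integrable fun x : ℝ => ((Real.exp (-(a * |x|)) : ℝ) : ℂ) := by
  have h : IntegrableOn (fun x : ℝ => Real.exp (-(a * |x|))) (Set.Iic 0 ∪ Set.Ioi 0) := by
    refine IntegrableOn.union ?_ ?_
    · refine (integrableOn_exp_mul_Iic ha 0).congr_fun (fun x hx => ?_) measurableSet_Iic
      simp only [abs_of_nonpos (Set.mem_Iic.mp hx), mul_neg, neg_neg]
    · refine (integrableOn_exp_mul_Ioi (neg_lt_zero.mpr ha) 0).congr_fun (fun x hx => ?_)
        measurableSet_Ioi
      simp only [abs_of_pos (Set.mem_Ioi.mp hx), neg_mul]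
  rw [Set.Iic_union_Ioi, integrableOn_univ] at h
  exact h.ofReal

/-- On each half-line the integrand is a pure exponential, with rates `z₁` and `z₂`; the two
integrals add up to `1/z₁ - 1/z₂`. -/
theorem fourier_exp_neg_mul_abs {a : ℝ} (ha : 0 < a) (w : ℝ) :
    𝓕 (fun x : ℝ => ((Real.exp (-(a * |x|)) : ℝ) : ℂ)) w =
      ((2 * a / (a ^ 2 + (2 * Real.pi * w) ^ 2) : ℝ) : ℂ) := by
  rw [Real.fourier_real_eq_integral_exp_smul]
  set z₁ : ℂ := a - 2 * Real.pi * w * Complex.I with hz₁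
  set z₂ : ℂ := -a - 2 * Real.pi * w * Complex.I with hz₂
  have hre₁ : z₁.re = a := by simp [z₁]
  have hre₂ : z₂.re = -a := by simp [z₂]
  have hne₁ : z₁ ≠ 0 := fun h => by rw [h, Complex.zero_re] at hre₁; exact ha.ne hre₁
  have hne₂ : z₂ ≠ 0 := fun h => by rw [h, Complex.zero_re] at hre₂; linarith
  set f : ℝ → ℂ := fun x => Complex.exp ((-2 * Real.pi * x * w : ℝ) * Complex.I) •
    ((Real.exp (-(a * |x|)) : ℝ) : ℂ)
  have hf₁ : Set.EqOn (fun x : ℝ => Complex.exp (z₁ * x)) f (Set.Iic 0) := fun x hx => by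
    simp only [f, abs_of_nonpos (Set.mem_Iic.mp hx), smul_eq_mul, Complex.ofReal_exp,
      ← Complex.exp_add, z₁]
    congr 1
    push_cast
    ring
  have hf₂ : Set.EqOn (fun x : ℝ => Complex.exp (z₂ * x)) f (Set.Ioi 0) := fun x hx => by
    simp only [f, abs_of_pos (Set.mem_Ioi.mp hx), smul_eq_mul, Complex.ofReal_exp,
      ← Complex.exp_add, z₂]
    congr 1
    push_cast
    ring
  have hi₁ := (integrableOn_exp_mul_complex_Iic (a := z₁) (by rwa [hre₁]) 0).congr_fun hf₁
    measurableSet_Iic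
  have hi₂ := (integrableOn_exp_mul_complex_Ioi (a := z₂) (by rw [hre₂]; linarith) 0).congr_fun hf₂
    measurableSet_Ioi
  rw [← intervalIntegral.integral_Iic_add_Ioi hi₁ hi₂, ← setIntegral_congr_fun measurableSet_Iic hf₁,
    ← setIntegral_congr_fun measurableSet_Ioi hf₂,
    integral_exp_mul_complex_Iic (by rwa [hre₁]), integral_exp_mul_complex_Ioi
      (by rw [hre₂]; linarith), Complex.ofReal_zero, mul_zero, mul_zero, Complex.exp_zero]
  have hprod : z₁ * -z₂ = ((a ^ 2 + (2 * Real.pi * w) ^ 2 : ℝ) : ℂ) := by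
    rw [hz₁, hz₂]
    push_cast
    linear_combination (-(2 * Real.pi * w) ^ 2 : ℂ) * Complex.I_sq
  have hD : ((a ^ 2 + (2 * Real.pi * w) ^ 2 : ℝ) : ℂ) ≠ 0 := by
    rw [← hprod]
    exact mul_ne_zero hne₁ (neg_ne_zero.mpr hne₂)
  rw [Complex.ofReal_div, eq_div_iff hD, ← hprod]
  have h3 : (1 / z₁ + -1 / z₂) * (z₁ * -z₂) = z₁ - z₂ := by
    field_simp
    ring
  rw [h3, hz₁, hz₂]
  push_cast
  ring

theorem integrable_lorentzian {a : ℝ} (ha : 0 < a) :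
    Integrable fun w : ℝ => ((2 * a / (a ^ 2 + (2 * Real.pi * w) ^ 2) : ℝ) : ℂ) := by
  have hpi := Real.pi_pos
  have hint := (integrable_inv_one_add_sq.comp_mul_left'
    (R := 2 * Real.pi / a) (by positivity)).const_mul (2 / a)
  have h : Integrable fun w : ℝ => 2 * a / (a ^ 2 + (2 * Real.pi * w) ^ 2) := by
    refine hint.congr (Filter.Eventually.of_forall fun w => ?_)
    simp only
    field_simp
  exact h.ofReal

/-- Fourier inversion for the two-sided exponential, whose transform is the Lorentzian. -/
theorem integral_exp_mul_lorentzian {a : ℝ} (ha : 0 < a) (s : ℝ) :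
    ∫ w : ℝ, Complex.exp ((s * (2 * Real.pi * w) : ℝ) * Complex.I) *
      ((2 * a / (a ^ 2 + (2 * Real.pi * w) ^ 2) : ℝ) : ℂ) = Real.exp (-(a * |s|)) := by
  set G : ℝ → ℂ := fun x => ((Real.exp (-(a * |x|)) : ℝ) : ℂ)
  have hF : 𝓕 G = fun w => ((2 * a / (a ^ 2 + (2 * Real.pi * w) ^ 2) : ℝ) : ℂ) :=
    funext fun w => fourier_exp_neg_mul_abs ha w
  have hG : Continuous G := by fun_prop
  have h := congrFun (hG.fourierInv_fourier_eq (integrable_exp_neg_mul_abs ha)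
    (hF ▸ integrable_lorentzian ha)) s
  rw [Real.fourierInv_eq_fourier_neg, hF, Real.fourier_real_eq_integral_exp_smul] at h
  refine Eq.trans (integral_congr_ae (Eventually.of_forall fun w => ?_)) h
  simp only [smul_eq_mul]
  congr 3
  push_cast
  ring

theorem inner_momPhase (φ : C(ℝ, ℝ)) (f : Env) :
    inner ℂ f (momPhase φ f) =
      ∫ w, Complex.exp (φ (2 * Real.pi * w) * Complex.I) * ((‖four f w‖ ^ 2 : ℝ) : ℂ) := by
  rw [momPhase, mul_assoc, mul_apply_eq_comp, ContinuousLinearMap.star_eq_adjoint,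
    ContinuousLinearMap.adjoint_inner_right, L2.inner_def]
  refine integral_congr_ae ?_
  filter_upwards [coeFn_phase (φ.comp wavenumber) (four f)] with w hw
  rw [mul_apply_eq_comp, hw, RCLike.inner_apply, mul_assoc, RCLike.mul_conj]
  push_cast
  rfl

theorem coeFn_four_cauchyState (γ : ℝ) : four (cauchyState γ) =ᵐ[volume]
    fun w => ((√(2 * Real.pi) * cauchyAmplitude γ (2 * Real.pi * w) : ℝ) : ℂ) := by
  have h : four (cauchyState γ) = (memLp_cauchy γ).toLp := by
    rw [four_apply, cauchyState, FourierTransform.fourier_fourierInv_eq]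
  rw [h]
  exact (memLp_cauchy γ).coeFn_toLp

/-- The momentum density in the frequency variable, with the Jacobian `2π` absorbed: a Lorentzian of
half-width `γ/2` in `k`. -/
theorem norm_sq_four_cauchyState {γ : ℝ} (hγ : 0 < γ) :
    (fun w => ‖four (cauchyState γ) w‖ ^ 2) =ᵐ[volume]
      fun w => 2 * (γ / 2) / ((γ / 2) ^ 2 + (2 * Real.pi * w) ^ 2) := by
  filter_upwards [coeFn_four_cauchyState γ] with w hw
  have hpi := Real.pi_pos
  rw [hw, Complex.norm_real, Real.norm_eq_abs, sq_abs, mul_pow, Real.sq_sqrt (by positivity),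
    cauchyAmplitude, Real.sq_sqrt (by positivity)]
  field_simp
  ring

/-- The characteristic function of the momentum distribution of the Cauchy state. -/
theorem inner_expP_cauchyState {γ : ℝ} (hγ : 0 < γ) (s : ℝ) :
    inner ℂ (cauchyState γ) (expP s (cauchyState γ)) = Real.exp (-(γ / 2 * |s|)) := by
  rw [expP, inner_momPhase, ← integral_exp_mul_lorentzian (half_pos hγ) s]
  refine integral_congr_ae ?_
  filter_upwards [norm_sq_four_cauchyState hγ] with w hw
  rw [hw]
  rfl

theorem norm_cauchyState {γ : ℝ} (hγ : 0 < γ) : ‖cauchyState γ‖ = 1 := by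
  have h := inner_expP_cauchyState hγ 0
  rw [isUnitaryGroup_p.map_zero, one_apply_eq_self, abs_zero, mul_zero, neg_zero, Real.exp_zero] at h
  have h2 : ‖cauchyState γ‖ ^ 2 = 1 := by
    rw [← inner_self_eq_norm_sq (𝕜 := ℂ), h, RCLike.re_to_complex, Complex.ofReal_re]
  exact (pow_eq_one_iff_of_nonneg (norm_nonneg _) two_ne_zero).mp h2

/-! ### The reduced dynamics -/

theorem blockDiag_apply (S : Fin 2 → Env →L[ℂ] Env) (ψ : Total) (i : Fin 2) :
    blockDiag (S 0) (S 1) ψ i = S i (ψ i) := by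
  fin_cases i <;> rfl

/-- The `(i, j)` block of the evolved state is the rank-one operator `ρ i j |S i ξ⟩⟨S j ξ|`, and
Parseval's identity evaluates its trace in the chosen basis. -/
theorem reducedState_blockDiag (S : Fin 2 → Env →L[ℂ] Env) (ρ : QMat) (ξ : Env) (i j : Fin 2) :
    reducedState (blockDiag (S 0) (S 1)) ρ ξ i j = ρ i j * inner ℂ (S j ξ) (S i ξ) := by
  have hb (x : Env) : block (blockDiag (S 0) (S 1) *
      tensorCLM ρ (InnerProductSpace.rankOne ℂ ξ ξ) * star (blockDiag (S 0) (S 1))) i j x =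
      (ρ i j * inner ℂ (S j ξ) x) • S i ξ := by
    rw [block, mul_apply_eq_comp, mul_apply_eq_comp, blockDiag_apply, tensorCLM_apply,
      star_blockDiag, Finset.sum_eq_single j]
    · rw [blockDiag_apply (fun i => star (S i))]
      simp only [Pi.single_eq_same, InnerProductSpace.rankOne_apply,
        ContinuousLinearMap.star_eq_adjoint, ContinuousLinearMap.adjoint_inner_right,
        ContinuousLinearMap.map_smul, smul_smul]
    · intro l _ hl
      rw [blockDiag_apply (fun i => star (S i))]
      simp only [Pi.single_eq_of_ne hl, ContinuousLinearMap.map_zero, smul_zero]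
    · simp
  rw [reducedState, partialTrace]
  simp only [hb, inner_smul_right]
  rw [← envBasis.tsum_inner_mul_inner (S j ξ) (S i ξ), ← tsum_mul_left]
  exact tsum_congr fun k => by ring

/-- The factor by which the coherence is multiplied after `n` cycles. -/
def coherence (γ : ℝ) (n : ℕ) (t : ℝ) : ℂ :=
  Complex.exp ((-(t ^ 3 / (8 * n)) : ℝ) * Complex.I) * Real.exp (-(t ^ 2 * γ / (4 * n)))

/-- Only the relative evolution `(S 1)* S 0` enters the coherence, so the common part of the two
blocks cancels. -/
theorem exists_Un_blocks {n : ℕ} (hn : 0 < n) (t : ℝ) :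
    ∃ S : Fin 2 → Env →L[ℂ] Env, Un n t = blockDiag (S 0) (S 1) ∧
      (∀ i, S i ∈ unitary (Env →L[ℂ] Env)) ∧
      S 0 = S 1 * (Complex.exp ((-(t ^ 3 / (8 * n)) : ℝ) * Complex.I) • expP (t ^ 2 / (2 * n))) := by
  have hn' : (n : ℝ) ≠ 0 := by positivity
  have hu (a b c s : ℝ) : metaWeyl a b c s ∈ unitary (Env →L[ℂ] Env) :=
    mul_mem (momPhase_mem_unitary _) (isUnitaryGroup_q.unitary_mem s)
  refine ⟨![metaWeyl (-(t / 2)) (-(t ^ 2 / 4) + t ^ 2 / (4 * n))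
      (-(t ^ 3 / 24) + t ^ 3 / (16 * n) - t ^ 3 / (48 * n ^ 2)) (-(t / 2)),
    metaWeyl (-(t / 2)) (-(t ^ 2 / 4) - t ^ 2 / (4 * n))
      (-(t ^ 3 / 24) - t ^ 3 / (16 * n) - t ^ 3 / (48 * n ^ 2)) (-(t / 2))], by rw [Un_eq, Un_zero_block hn, Un_one_block hn]; rfl, ?_, ?_⟩
  · exact Fin.forall_fin_two.mpr ⟨hu _ _ _ _, hu _ _ _ _⟩
  · simp only [Matrix.cons_val_zero, Matrix.cons_val_one]
    -- The constant coefficients differ by `t³/(8n)`, but moving `e^{-i(t/2)q}` past `e^{i(t²/2n)p}`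
    -- already supplies `t³/(4n)`; hence the phase `-t³/(8n)`.
    rw [expP_eq, exp_smul_metaWeyl, metaWeyl_mul]
    congr 1 <;> field_simp <;> ring

/-- Unitary blocks preserve the norm of the environment state, so populations are fixed and the
channel is pure dephasing. -/
theorem qubitState_apply {γ : ℝ} (hγ : 0 < γ) {n : ℕ} (hn : 0 < n) (ρ : QMat) (t : ℝ) :
    qubitState γ n ρ t = !![ρ 0 0, ρ 0 1 * coherence γ n t;
      ρ 1 0 * conj (coherence γ n t), ρ 1 1] := by
  obtain ⟨S, hS, hu, h01⟩ := exists_Un_blocks hn t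
  have hinner (i : Fin 2) (x y : Env) : inner ℂ (S i x) (S i y) = inner ℂ x y := by
    rw [← ContinuousLinearMap.adjoint_inner_right, ← ContinuousLinearMap.star_eq_adjoint,
      ← mul_apply_eq_comp, Unitary.star_mul_self_of_mem (hu i), one_apply_eq_self]
  have hself (i : Fin 2) : ‖S i (cauchyState γ)‖ = 1 := by
    rw [@norm_eq_sqrt_re_inner ℂ, hinner, ← @norm_eq_sqrt_re_inner ℂ, norm_cauchyState hγ]
  have hc : inner ℂ (S 1 (cauchyState γ)) (S 0 (cauchyState γ)) = coherence γ n t := by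
    rw [h01, mul_apply_eq_comp, hinner, _root_.smul_apply, inner_smul_right,
      inner_expP_cauchyState hγ, coherence, abs_of_nonneg (by positivity)]
    congr 4
    field_simp
    ring
  ext i j
  rw [qubitState, hS, reducedState_blockDiag]
  fin_cases i <;> fin_cases j
  · simp [hself]
  · simp [hc]
  · simp [← hc]
  · simp [hself]

theorem coherence_re (γ : ℝ) (n : ℕ) (t : ℝ) : (coherence γ n t).re =
    Real.cos (t ^ 3 / (8 * n)) * Real.exp (-(t ^ 2 * γ / (4 * n))) := by
  rw [coherence, Complex.re_mul_ofReal, Complex.exp_ofReal_mul_I_re, Real.cos_neg]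

theorem norm_coherence (γ : ℝ) (n : ℕ) (t : ℝ) :
    ‖coherence γ n t‖ = Real.exp (-(t ^ 2 * γ / (4 * n))) := by
  rw [coherence, norm_mul, norm_cexp_mul_I, one_mul, Complex.norm_real,
    Real.norm_of_nonneg (Real.exp_pos _).le]

theorem norm_coherence_sub_one_sq (γ : ℝ) (n : ℕ) (t : ℝ) : ‖coherence γ n t - 1‖ ^ 2 =
    1 - 2 * Real.cos (t ^ 3 / (8 * n)) * Real.exp (-(t ^ 2 * γ / (4 * n))) +
      Real.exp (-(t ^ 2 * γ / (2 * n))) := by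
  have h : Real.exp (-(t ^ 2 * γ / (2 * n))) = ‖coherence γ n t‖ ^ 2 := by
    rw [norm_coherence, pow_two (Real.exp _), ← Real.exp_add]
    congr 1
    -- For `n = 0` division by zero makes both exponents 0, so the identity survives.
    rcases eq_or_ne (n : ℝ) 0 with h0 | h0
    · simp [h0]
    · field_simp
      ring
  rw [h, mul_assoc, ← coherence_re, Complex.sq_norm, Complex.sq_norm, Complex.normSq_apply,
    Complex.normSq_apply, Complex.sub_re, Complex.sub_im, Complex.one_re, Complex.one_im]
  ring

theorem hsNormSq_qubitState_sub {γ : ℝ} (hγ : 0 < γ) {n : ℕ} (hn : 0 < n) (ρ : QMat) (t : ℝ) :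
    hsNormSq (qubitState γ n ρ t - ρ) =
      (‖ρ 0 1‖ ^ 2 + ‖ρ 1 0‖ ^ 2) * ‖coherence γ n t - 1‖ ^ 2 := by
  have h1 : ρ 0 1 * coherence γ n t - ρ 0 1 = ρ 0 1 * (coherence γ n t - 1) := by ring
  have h2 : ρ 1 0 * conj (coherence γ n t) - ρ 1 0 = ρ 1 0 * conj (coherence γ n t - 1) := by
    rw [map_sub, map_one]; ring
  rw [qubitState_apply hγ hn]
  simp only [hsNormSq, Fin.sum_univ_two, Matrix.sub_apply, Matrix.of_apply, Matrix.cons_val_zero,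
    Matrix.cons_val_one, Matrix.cons_val', Matrix.cons_val_fin_one, sub_self, norm_zero, h1, h2,
    norm_mul, RCLike.norm_conj]
  ring

theorem plusState_apply (i j : Fin 2) : plusState i j = 1 / 2 := by
  have h : (1 / ((√2 : ℝ) : ℂ)) * (1 / ((√2 : ℝ) : ℂ)) = 1 / 2 := by
    rw [div_mul_div_comm, one_mul, ← Complex.ofReal_mul, Real.mul_self_sqrt (by norm_num)]
    norm_num
  fin_cases i <;> fin_cases j <;>
    simpa [plusState, plusVec, Matrix.vecMulVec_apply] using h

theorem isDensity_plusState : IsDensity plusState := by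
  refine ⟨Matrix.posSemidef_vecMulVec_self_star _, ?_⟩
  rw [Matrix.trace_fin_two, plusState_apply, plusState_apply]
  norm_num

theorem plusFidelity_eq (ρ : QMat) :
    plusFidelity ρ = (ρ 0 0 + ρ 0 1 + ρ 1 0 + ρ 1 1).re / 2 := by
  have h : star plusVec ⬝ᵥ (ρ *ᵥ plusVec) = ∑ i, ∑ j, plusState j i * ρ i j := by
    simp only [dotProduct, Matrix.mulVec, Finset.mul_sum, plusState, Matrix.vecMulVec_apply]
    exact Finset.sum_congr rfl fun i _ => Finset.sum_congr rfl fun j _ => by ring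
  rw [plusFidelity, h]
  simp only [plusState_apply, Fin.sum_univ_two]
  rw [← mul_add, ← mul_add, ← mul_add, one_div, ← Complex.ofReal_ofNat, ← Complex.ofReal_inv,
    Complex.re_ofReal_mul, add_assoc (ρ 0 0 + ρ 0 1)]
  ring

theorem decoupling_error {γ : ℝ} (hγ : 0 < γ) {n : ℕ} (hn : 0 < n) (t : ℝ) :
    2 * (1 - plusFidelity (qubitState γ n plusState t)) =
      1 - Real.cos (t ^ 3 / (8 * n)) * Real.exp (-(t ^ 2 * γ / (4 * n))) := by
  rw [plusFidelity_eq, qubitState_apply hγ hn, ← coherence_re]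
  simp [plusState_apply]
  ring

theorem hsNormSq_plusState {γ : ℝ} (hγ : 0 < γ) {n : ℕ} (hn : 0 < n) (t : ℝ) :
    hsNormSq (qubitState γ n plusState t - plusState) = ‖coherence γ n t - 1‖ ^ 2 / 2 := by
  rw [hsNormSq_qubitState_sub hγ hn, plusState_apply, plusState_apply]
  norm_num
  ring

/-- A nonnegative determinant gives `|ρ₀₁|² ≤ ρ₀₀ ρ₁₁`, and unit trace bounds the product by `1/4`.
-/
theorem IsDensity.norm_offDiag_le {ρ : QMat} (h : IsDensity ρ) :
    ‖ρ 0 1‖ ^ 2 + ‖ρ 1 0‖ ^ 2 ≤ 1 / 2 := by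
  obtain ⟨hpos, htr⟩ := h
  have hherm := hpos.isHermitian
  have h10 : ρ 1 0 = conj (ρ 0 1) := (hherm.apply 1 0).symm
  have h00 : ρ 0 0 = ((ρ 0 0).re : ℂ) := (Complex.conj_eq_iff_re.mp (hherm.apply 0 0)).symm
  have h11 : ρ 1 1 = ((ρ 1 1).re : ℂ) := (Complex.conj_eq_iff_re.mp (hherm.apply 1 1)).symm
  have hdet := hpos.det_nonneg
  rw [Matrix.det_fin_two, h10, Complex.mul_conj, Complex.normSq_eq_norm_sq, h00, h11] at hdet
  have hdet' : 0 ≤ (ρ 0 0).re * (ρ 1 1).re - ‖ρ 0 1‖ ^ 2 := by exact_mod_cast hdet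
  rw [Matrix.trace_fin_two] at htr
  have htr' : (ρ 0 0).re + (ρ 1 1).re = 1 := by
    rw [← Complex.add_re, htr, Complex.one_re]
  rw [h10, RCLike.norm_conj]
  nlinarith [sq_nonneg ((ρ 0 0).re - (ρ 1 1).re)]

/-- The error is a nonnegative factor independent of `ρ` times the squared size of the off-diagonal
part, whose bound `1/2` is attained by `|+⟩⟨+|`. -/
theorem isGreatest_hsNormSq {γ : ℝ} (hγ : 0 < γ) {n : ℕ} (hn : 0 < n) (t : ℝ) :
    IsGreatest {e : ℝ | ∃ ρ, IsDensity ρ ∧ e = hsNormSq (qubitState γ n ρ t - ρ)}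
      (hsNormSq (qubitState γ n plusState t - plusState)) := by
  refine ⟨⟨plusState, isDensity_plusState, rfl⟩, ?_⟩
  rintro _ ⟨ρ, hρ, rfl⟩
  rw [hsNormSq_plusState hγ hn, hsNormSq_qubitState_sub hγ hn]
  nlinarith [hρ.norm_offDiag_le, sq_nonneg ‖coherence γ n t - 1‖]

/-! ### Limits of the errors -/

/-- The factor is a continuous function of `1/n` with value 1 at 0. -/
theorem tendsto_coherence_nat (γ t : ℝ) :
    Tendsto (fun n : ℕ => coherence γ n t) atTop (𝓝 1) := by
  have h := (Continuous.tendsto (f := fun ε : ℝ =>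
    Complex.exp ((-(t ^ 3 / 8 * ε) : ℝ) * Complex.I) * (Real.exp (-(t ^ 2 * γ / 4 * ε)) : ℝ))
      (by fun_prop) 0).comp tendsto_one_div_atTop_nhds_zero_nat
  simp only [mul_zero, neg_zero, Complex.ofReal_zero, zero_mul, Complex.exp_zero, Real.exp_zero,
    Complex.ofReal_one, mul_one] at h
  refine h.congr fun n => ?_
  simp only [Function.comp_apply, coherence, one_div, ← div_eq_mul_inv, div_div]

/-- The phase does not depend on `γ`, so only the exponential decay of the modulus matters; its rate
`t²/(4n)` is positive because `t ≠ 0`. -/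
theorem tendsto_coherence_width {n : ℕ} (hn : 0 < n) {t : ℝ} (ht : t ≠ 0) :
    Tendsto (fun γ : ℝ => coherence γ n t) atTop (𝓝 0) := by
  rw [tendsto_zero_iff_norm_tendsto_zero]
  simp only [norm_coherence]
  refine Real.tendsto_exp_neg_atTop_nhds_zero.comp ?_
  have hc : 0 < t ^ 2 / (4 * n) := by positivity
  refine (tendsto_id.const_mul_atTop hc).congr fun γ => ?_
  simp only [id]
  ring

theorem error_eq_coherence {γ : ℝ} (hγ : 0 < γ) {n : ℕ} (hn : 0 < n) (t : ℝ) :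
    2 * (1 - plusFidelity (qubitState γ n plusState t)) = 1 - (coherence γ n t).re := by
  rw [decoupling_error hγ hn, coherence_re]

theorem hsNormSq_plusState_eq {γ : ℝ} (hγ : 0 < γ) {n : ℕ} (hn : 0 < n) (t : ℝ) :
    hsNormSq (qubitState γ n plusState t - plusState) =
      (1 - 2 * Real.cos (t ^ 3 / (8 * n)) * Real.exp (-(t ^ 2 * γ / (4 * n))) +
        Real.exp (-(t ^ 2 * γ / (2 * n)))) / 2 := by
  rw [hsNormSq_plusState hγ hn, norm_coherence_sub_one_sq]

theorem continuous_error_coherence : Continuous fun z : ℂ => 1 - z.re := by fun_prop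

theorem continuous_hs_coherence : Continuous fun z : ℂ => ‖z - 1‖ ^ 2 / 2 := by fun_prop

theorem tendsto_errors_nat {γ : ℝ} (hγ : 0 < γ) (t : ℝ) :
    Tendsto (fun n : ℕ => 2 * (1 - plusFidelity (qubitState γ n plusState t))) atTop (𝓝 0) ∧
      Tendsto (fun n : ℕ => hsNormSq (qubitState γ n plusState t - plusState)) atTop (𝓝 0) := by
  have h := tendsto_coherence_nat γ t
  constructor
  · have h1 := (continuous_error_coherence.tendsto 1).comp h
    rw [Complex.one_re, sub_self] at h1
    refine h1.congr' ?_
    filter_upwards [eventually_gt_atTop 0] with n hn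
    exact (error_eq_coherence hγ hn t).symm
  · have h1 := (continuous_hs_coherence.tendsto 1).comp h
    rw [sub_self, norm_zero, zero_pow two_ne_zero, zero_div] at h1
    refine h1.congr' ?_
    filter_upwards [eventually_gt_atTop 0] with n hn
    exact (hsNormSq_plusState hγ hn t).symm

theorem tendsto_errors_width {n : ℕ} (hn : 0 < n) {t : ℝ} (ht : t ≠ 0) :
    Tendsto (fun γ : ℝ => 2 * (1 - plusFidelity (qubitState γ n plusState t))) atTop (𝓝 1) ∧
      Tendsto (fun γ : ℝ => hsNormSq (qubitState γ n plusState t - plusState)) atTop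
        (𝓝 (1 / 2)) := by
  have h := tendsto_coherence_width hn ht
  constructor
  · have h1 := (continuous_error_coherence.tendsto 0).comp h
    rw [Complex.zero_re, sub_zero] at h1
    refine h1.congr' ?_
    filter_upwards [eventually_gt_atTop 0] with γ hγ
    exact (error_eq_coherence hγ hn t).symm
  · have h1 := (continuous_hs_coherence.tendsto 0).comp h
    rw [zero_sub, norm_neg, norm_one, one_pow] at h1
    refine h1.congr' ?_
    filter_upwards [eventually_gt_atTop 0] with γ hγ
    exact (hsNormSq_plusState hγ hn t).symm

theorem tendsto_qubitState_width {n : ℕ} (hn : 0 < n) {t : ℝ} (ht : t ≠ 0) :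
    Tendsto (fun γ : ℝ => qubitState γ n plusState t) atTop (𝓝 ((1 / 2 : ℂ) • 1)) := by
  have hF : Continuous fun z : ℂ =>
      (!![1 / 2, 1 / 2 * z; 1 / 2 * conj z, 1 / 2] : QMat) := by
    refine continuous_matrix fun i j => ?_
    fin_cases i <;> fin_cases j <;> simp <;> fun_prop
  have h := (hF.tendsto 0).comp (tendsto_coherence_width hn ht)
  have h0 : (!![1 / 2, 1 / 2 * 0; 1 / 2 * conj 0, 1 / 2] : QMat) = (1 / 2 : ℂ) • 1 := by
    ext i j
    fin_cases i <;> fin_cases j <;> simp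
  rw [h0] at h
  refine h.congr' ?_
  filter_upwards [eventually_gt_atTop 0] with γ hγ
  simp only [qubitState_apply hγ hn, plusState_apply, Function.comp_apply]

theorem isUnitaryGroup_expI_conjOp_ham {v : QMat} (hv : v ∈ ({1, pauliX} : Set QMat)) :
    IsUnitaryGroup (conjOp (onQubit v) ham) (expI (conjOp (onQubit v) ham)) := by
  rcases hv with rfl | rfl
  · rw [conjOp_one_ham]
    exact isUnitaryGroup_ham.expI_spec
  · exact isUnitaryGroup_conjOp_pauliX_ham.expI_spec

end Decoupling

end

/-! ### The main theorem -/

theorem mainTheorem4 :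
    -- the operators are self-adjoint, and the unitary groups used below exist
    (IsSelfAdjoint q ∧ IsSelfAdjoint p ∧ IsSelfAdjoint p2 ∧ IsSelfAdjoint ham) ∧
    (schwartz ≤ (q + p2).domain ∧ IsSelfAdjoint qAddP2) ∧
    (ham + conjOp (onQubit pauliX) ham = tensorOp 1 (q + p2) ∧
      IsSelfAdjoint (tensorOp 1 (q + p2)).closure) ∧
    ((∀ v ∈ ({1, pauliX} : Set QMat),
        IsUnitaryGroup (conjOp (onQubit v) ham) (expI (conjOp (onQubit v) ham))) ∧
      IsUnitaryGroup ham (expI ham) ∧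
      IsUnitaryGroup (tensorOp 1 ((1 / 2 : ℂ) • qAddP2))
        (expI (tensorOp 1 ((1 / 2 : ℂ) • qAddP2))) ∧
      (∀ c : ℝ, IsUnitaryGroup (tensorOp 1 qAddP2 + scalarOp (c : ℂ))
        (expI (tensorOp 1 qAddP2 + scalarOp (c : ℂ)))) ∧
      IsUnitaryGroup (tensorOp pauliZ (scalarOp 1)) (expI (tensorOp pauliZ (scalarOp 1))) ∧
      IsUnitaryGroup (tensorOp pauliZ p) (expI (tensorOp pauliZ p))) ∧
    -- dynamical decoupling works uniformly
    (IsSelfAdjoint ((1 / 2 : ℂ) • qAddP2) ∧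
      DecouplesUniformly {1, pauliX} ham ((1 / 2 : ℂ) • qAddP2)) ∧
    -- the factorized form of the evolution
    (∀ (n : ℕ) (t : ℝ), 0 < n →
      Un n t =
        expI (tensorOp 1 qAddP2 + scalarOp ((t ^ 2 / (24 * n ^ 2) : ℝ) : ℂ)) (-(t / 2)) *
        expI (tensorOp pauliZ (scalarOp 1)) (-(t ^ 3 / (16 * n))) *
        expI (tensorOp pauliZ p) (t ^ 2 / (4 * n))) ∧
    -- the initial states are states
    (IsDensity plusState ∧ ∀ γ : ℝ, 0 < γ → ‖cauchyState γ‖ = 1) ∧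
    -- the decoupling error
    (∀ (γ : ℝ) (n : ℕ) (t : ℝ), 0 < γ → 0 < n →
      2 * (1 - plusFidelity (qubitState γ n plusState t)) =
        1 - Real.cos (t ^ 3 / (8 * n)) * Real.exp (-(t ^ 2 * γ / (4 * n))) ∧
      hsNormSq (qubitState γ n plusState t - plusState) =
        (1 - 2 * Real.cos (t ^ 3 / (8 * n)) * Real.exp (-(t ^ 2 * γ / (4 * n))) +
          Real.exp (-(t ^ 2 * γ / (2 * n)))) / 2 ∧
      -- `|+⟩` is the worst case
      IsGreatest {e : ℝ | ∃ ρ, IsDensity ρ ∧ e = hsNormSq (qubitState γ n ρ t - ρ)}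
        (hsNormSq (qubitState γ n plusState t - plusState))) ∧
    -- the error vanishes for `n → ∞`
    (∀ (γ t : ℝ), 0 < γ →
      Tendsto (fun n : ℕ => 2 * (1 - plusFidelity (qubitState γ n plusState t))) atTop (𝓝 0) ∧
      Tendsto (fun n : ℕ => hsNormSq (qubitState γ n plusState t - plusState)) atTop (𝓝 0)) ∧
    -- for fixed `n` and `t ≠ 0`, the choice of `γ` makes decoupling arbitrarily bad
    (∀ (n : ℕ) (t : ℝ), 0 < n → t ≠ 0 →
      Tendsto (fun γ : ℝ => qubitState γ n plusState t) atTop (𝓝 ((1 / 2 : ℂ) • 1)) ∧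
      Tendsto (fun γ : ℝ => 2 * (1 - plusFidelity (qubitState γ n plusState t))) atTop (𝓝 1) ∧
      Tendsto (fun γ : ℝ => hsNormSq (qubitState γ n plusState t - plusState)) atTop
        (𝓝 (1 / 2))) := by
  refine ⟨⟨isUnitaryGroup_q.isSelfAdjoint, isUnitaryGroup_p.isSelfAdjoint,
    isUnitaryGroup_p2.isSelfAdjoint, isUnitaryGroup_ham.isSelfAdjoint⟩,
    ⟨schwartz_le_domain, isUnitaryGroup_qAddP2.isSelfAdjoint⟩, ⟨ham_add_conjOp_ham, ?_⟩,
    ⟨fun v hv => isUnitaryGroup_expI_conjOp_ham hv, isUnitaryGroup_ham.expI_spec,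
      (isUnitaryGroup_tensorOp_one isUnitaryGroup_half_qAddP2).expI_spec,
      fun c => (isUnitaryGroup_qAddP2_add_scalarOp c).expI_spec,
      isUnitaryGroup_pauliZ_one.expI_spec,
      (isUnitaryGroup_tensorOp_pauliZ isUnitaryGroup_p).expI_spec⟩,
    ⟨isUnitaryGroup_half_qAddP2.isSelfAdjoint, decouplesUniformly⟩,
    fun n t hn => Un_factorization hn t,
    ⟨isDensity_plusState, fun γ hγ => norm_cauchyState hγ⟩,
    fun γ n t hγ hn => ⟨decoupling_error hγ hn t, hsNormSq_plusState_eq hγ hn t,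
      isGreatest_hsNormSq hγ hn t⟩,
    fun γ t hγ => tendsto_errors_nat hγ t,
    fun n t hn ht => ⟨tendsto_qubitState_width hn ht, tendsto_errors_width hn ht⟩⟩
  rw [closure_tensorOp_q_add_p2]
  exact (isUnitaryGroup_tensorOp_one isUnitaryGroup_qAddP2).isSelfAdjoint
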